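/- There is an algorithm (a fixed program for a unit-cost random access machine with addition, subtraction, multiplication, comparison and indirect addressing) with the following property. Given any sequence $d_1,\dots,d_r$ of $r$ positive integers with $\sum_{i=1}^r d_i = 2r-2$ (equivalently, for $r\ge 2$, the degree sequence of a tree on $r$ vertices), in arbitrary order, the algorithm outputs, as a list of edges, a tree $T$ with $r$ vertices whose vertex degrees are $d_1,\dots,d_r$ (in some order) such that $$W(T')\le W(T)\qquad\text{for every tree } T' \text{ with degree sequence } d_1,\dots,d_r,$$ where the Wiener index $W(G)=\sum_{\{u,v\}}\operatorname{dist}_G(u,v)$ of a connected graph $G$ is the sum of the distances over all unordered pairs of vertices. It halts after at most $C r^2$ steps and handles only natural numbers of size at most $r^k$ (that is, words of $O(\log r)$ bits), where the constants $C$ and $k$ do not depend on $r$ or on the sequence. -/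

import Mathlib

namespace WienerTree

/-! ### Trees, degree sequences, Wiener index -/

open Classical in
/-- The Wiener index of a finite graph: the sum of the distances over all unordered pairs of
vertices (the degenerate pairs `s(v, v)` contribute `0`). -/
noncomputable def wienerIndex {V : Type*} [Fintype V] (G : SimpleGraph V) : ℕ :=
  ∑ p : Sym2 V, Sym2.lift ⟨fun u v => G.dist u v, fun _ _ => G.dist_comm⟩ p

open Classical in
/-- `G` has degree sequence `d 0, …, d (r - 1)`: the vertices of `G` can be listed in such a way
that the `i`-th vertex has degree `d i`. -/
def HasDegreeSequence {V : Type*} [Fintype V] (G : SimpleGraph V) {r : ℕ} (d : Fin r → ℕ) : Prop :=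
  ∃ e : Fin r ≃ V, ∀ i, G.degree (e i) = d i

/-! ### The machine model

A random access machine over natural numbers, programmed in structured form.  The machine has
registers `0, 1, 2, …` and memory arrays `0, 1, 2, …`, each array with cells `0, 1, 2, …`.  Registers
and arrays are named by constants of the program (so a program uses finitely many of them), while
cells of an array are addressed by computed values.  Every elementary operation costs one step.
There is a word bound `W`: no number that the machine ever handles may exceed `W`; a computation
that would exceed it is stuck. -/

/-- The contents of the registers and of the memory arrays. -/
structure State where
  reg : ℕ → ℕ
  mem : ℕ → ℕ → ℕ

/-- The state after writing `n` to register `x`. -/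
def State.setReg (s : State) (x n : ℕ) : State :=
  { s with reg := Function.update s.reg x n }

/-- The state after writing `n` to cell `i` of array `a`. -/
def State.setMem (s : State) (a i n : ℕ) : State :=
  { s with mem := Function.update s.mem a (Function.update (s.mem a) i n) }

/-- Arithmetic expressions. -/
inductive Expr where
  /-- a constant -/
  | lit (n : ℕ)
  /-- the content of register `x` -/
  | reg (x : ℕ)
  /-- the content of array `a` at the cell whose address is the value of `i` -/
  | read (a : ℕ) (i : Expr)
  | add (e₁ e₂ : Expr)
  /-- truncated subtraction -/
  | sub (e₁ e₂ : Expr)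
  | mul (e₁ e₂ : Expr)

namespace Expr

/-- The value of an expression. -/
def eval (s : State) : Expr → ℕ
  | lit n => n
  | reg x => s.reg x
  | read a i => s.mem a (i.eval s)
  | add e₁ e₂ => e₁.eval s + e₂.eval s
  | sub e₁ e₂ => e₁.eval s - e₂.eval s
  | mul e₁ e₂ => e₁.eval s * e₂.eval s

/-- The number of steps for evaluating an expression: one for each constant, each access to a
register or a memory cell, and each arithmetic operation. -/
def cost : Expr → ℕ
  | lit _ => 1
  | reg _ => 1
  | read _ i => i.cost + 1
  | add e₁ e₂ => e₁.cost + e₂.cost + 1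
  | sub e₁ e₂ => e₁.cost + e₂.cost + 1
  | mul e₁ e₂ => e₁.cost + e₂.cost + 1

/-- All numbers that occur in the evaluation (constants, addresses, contents of registers and
cells, intermediate results) respect the word bound `W`. -/
def Fits (W : ℕ) (s : State) : Expr → Prop
  | lit n => n ≤ W
  | reg x => s.reg x ≤ W
  | read a i => i.Fits W s ∧ s.mem a (i.eval s) ≤ W
  | add e₁ e₂ => e₁.Fits W s ∧ e₂.Fits W s ∧ e₁.eval s + e₂.eval s ≤ W
  | sub e₁ e₂ => e₁.Fits W s ∧ e₂.Fits W s
  | mul e₁ e₂ => e₁.Fits W s ∧ e₂.Fits W s ∧ e₁.eval s * e₂.eval s ≤ W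

end Expr

/-- Programs. -/
inductive Program where
  | skip
  /-- register `x` becomes the value of `e` -/
  | assign (x : ℕ) (e : Expr)
  /-- the cell of array `a` with address the value of `i` becomes the value of `e` -/
  | store (a : ℕ) (i e : Expr)
  /-- first `p`, then `q` -/
  | seq (p q : Program)
  /-- if `e₁ < e₂` then `p` else `q` -/
  | ifLt (e₁ e₂ : Expr) (p q : Program)
  /-- while `e₁ < e₂` do `p` -/
  | whileLt (e₁ e₂ : Expr) (p : Program)

/-- `Exec W p s t s'`: on a machine with word bound `W`, the program `p` started in state `s` halts
in state `s'` after exactly `t` steps, and no number handled on the way exceeds `W`. -/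
inductive Exec (W : ℕ) : Program → State → ℕ → State → Prop
  | skip (s : State) : Exec W .skip s 1 s
  | assign (x : ℕ) (e : Expr) (s : State) (he : e.Fits W s) :
      Exec W (.assign x e) s (e.cost + 1) (s.setReg x (e.eval s))
  | store (a : ℕ) (i e : Expr) (s : State) (hi : i.Fits W s) (he : e.Fits W s) :
      Exec W (.store a i e) s (i.cost + e.cost + 1) (s.setMem a (i.eval s) (e.eval s))
  | seq {p q : Program} {s s₁ s₂ : State} {t₁ t₂ : ℕ}
      (hp : Exec W p s t₁ s₁) (hq : Exec W q s₁ t₂ s₂) :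
      Exec W (.seq p q) s (t₁ + t₂) s₂
  | ifTrue {e₁ e₂ : Expr} {p q : Program} {s s' : State} {t : ℕ}
      (h₁ : e₁.Fits W s) (h₂ : e₂.Fits W s) (hlt : e₁.eval s < e₂.eval s)
      (hp : Exec W p s t s') :
      Exec W (.ifLt e₁ e₂ p q) s (e₁.cost + e₂.cost + 1 + t) s'
  | ifFalse {e₁ e₂ : Expr} {p q : Program} {s s' : State} {t : ℕ}
      (h₁ : e₁.Fits W s) (h₂ : e₂.Fits W s) (hlt : ¬ e₁.eval s < e₂.eval s)
      (hq : Exec W q s t s') :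
      Exec W (.ifLt e₁ e₂ p q) s (e₁.cost + e₂.cost + 1 + t) s'
  | whileTrue {e₁ e₂ : Expr} {p : Program} {s s₁ s₂ : State} {t₁ t₂ : ℕ}
      (h₁ : e₁.Fits W s) (h₂ : e₂.Fits W s) (hlt : e₁.eval s < e₂.eval s)
      (hp : Exec W p s t₁ s₁) (hrest : Exec W (.whileLt e₁ e₂ p) s₁ t₂ s₂) :
      Exec W (.whileLt e₁ e₂ p) s (e₁.cost + e₂.cost + 1 + t₁ + t₂) s₂
  | whileFalse {e₁ e₂ : Expr} {p : Program} {s : State}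
      (h₁ : e₁.Fits W s) (h₂ : e₂.Fits W s) (hlt : ¬ e₁.eval s < e₂.eval s) :
      Exec W (.whileLt e₁ e₂ p) s (e₁.cost + e₂.cost + 1) s

/-! ### Input and output -/

/-- The initial state for the input `d 0, …, d (r - 1)`: register `0` holds `r`, the first `r` cells
of array `0` hold the sequence, and everything else is `0`. -/
def State.input {r : ℕ} (d : Fin r → ℕ) : State where
  reg x := if x = 0 then r else 0
  mem a i := if h : a = 0 ∧ i < r then d ⟨i, h.2⟩ else 0

/-- The state holds the graph `G` on the vertices `0, …, r - 1` as a list of `r - 1` edges: cell `j`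
of array `1` and cell `j` of array `2` hold the two ends of the `j`-th edge, for `0 ≤ j < r - 1`. -/
def State.HoldsGraph (s : State) {r : ℕ} (G : SimpleGraph (Fin r)) : Prop :=
  (∀ j, j + 1 < r → s.mem 1 j < r ∧ s.mem 2 j < r) ∧
  ∀ u v : Fin r, G.Adj u v ↔
    ∃ j, j + 1 < r ∧
      ((s.mem 1 j = u ∧ s.mem 2 j = v) ∨ (s.mem 1 j = v ∧ s.mem 2 j = u))

end WienerTree

namespace WienerTree

/-! ### Sums over the gaps of a sequence of weights -/

/-! Write y(v) = deg v - 1. In a tree on r vertices rooted at v, every w ≠ v has exactly one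
neighbour closer to v, so counting edge ends by distance gives ∑ y(w) d(v,w) = ∑ d(v,w) - (r-1).
Using this at both ends of a pair turns 2W into the constant 2(r-1)² plus ∑∑ y(u) y(v) d(u,v)
(`wienerIndex_eq_weighted`). Leaves drop out, and a weighted sum of distances with prescribed
nonzero weights remains to be maximized.

Paths are best (`exists_gapSum_ge_of_isTree`). Merge a leaf of least weight z into its neighbour,
arrange the weights of the smaller tree on a path by induction, and split the merged weight again.
Merging costs exactly 2z times the remaining weight. Splitting on the suitable side regains at least
this, because another leaf weighs at least z. On a path the weighted sum is twice `gapSum`, since a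
gap is counted by the ordered pairs that it separates. A caterpillar realizes every arrangement of
the weights along its spine, so it suffices to maximize `gapSum` over permutations.

An exchange argument moves the largest weight to one of the two ends without loss. Hence some
optimal arrangement places the weights in descending order from the outside to the inside, with a
left/right choice each time (`gapSum_le_bestGapSum`). After t placements the remaining problem
depends only on t and the total L on the left, because the total on the right is the t-th prefix sum
minus L. The reduced degrees sum to r-2, so there are O(r²) states, each evaluated in constant time
from the next row of a table.

The program collects the nonzero reduced degrees in descending order by O(r) scans of the input,
fills the table, replays the choices while marking where each block of children begins, and reads
off the parents in one sweep. Table entries are at most r³ + r² and addresses are quadratic, so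
words polynomial in r suffice. -/

/-- The sum, over all gaps of the sequence `l` of weights (including the two outer gaps), of the
product of the total weights on the two sides, where `L` is an additional weight on the left and
`R` an additional weight on the right. -/
def gapSum (L R : ℕ) : List ℕ → ℕ
  | [] => L * R
  | a :: l => L * (a + l.sum + R) + gapSum (L + a) R l

/-- The largest value of `gapSum` among the arrangements that place the weights of the list, in the
given order, from the outside to the inside. -/
def bestGapSum (L R : ℕ) : List ℕ → ℕ
  | [] => L * R
  | a :: l => max (L * (a + l.sum + R) + bestGapSum (L + a) R l)
      (R * (a + l.sum + L) + bestGapSum L (R + a) l)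

/-- An arrangement from the outside to the inside that attains `bestGapSum`. -/
def bestArrangement (L R : ℕ) : List ℕ → List ℕ
  | [] => []
  | a :: l =>
      if L * (a + l.sum + R) + bestGapSum (L + a) R l <
          R * (a + l.sum + L) + bestGapSum L (R + a) l then
        bestArrangement L (R + a) l ++ [a]
      else a :: bestArrangement (L + a) R l

/-- Mirror image of the defining recursion: it peels off the rightmost weight. -/
theorem gapSum_concat (L R : ℕ) (l : List ℕ) (a : ℕ) :
    gapSum L R (l ++ [a]) = gapSum L (R + a) l + (L + l.sum + a) * R := by
  induction l generalizing L with
  | nil => simp only [List.nil_append, gapSum, List.sum_nil]; ring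
  | cons b l ih =>
    simp only [List.cons_append, gapSum, ih, List.sum_append, List.sum_cons, List.sum_nil]; ring

/-- The weight `a` passes the entries of `p` one at a time. Swapping adjacent `x ≤ a` changes only
the gap between them and gains `a - x` times the excess of the weight to their right over the weight
to their left, which the hypothesis keeps nonnegative. -/
theorem gapSum_move_left {L R a : ℕ} {p s : List ℕ} (ha : ∀ x ∈ p, x ≤ a)
    (h : L + p.sum ≤ s.sum + R) : gapSum L R (p ++ a :: s) ≤ gapSum L R (a :: (p ++ s)) := by
  induction p generalizing L with
  | nil => simp
  | cons x p ih =>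
    have hx : x ≤ a := ha x (by simp)
    have h' : (L + x) + p.sum ≤ s.sum + R := by simp at h; omega
    have := ih (fun y hy => ha y (by simp [hy])) h'
    simp only [List.cons_append, gapSum] at this ⊢
    simp only [List.sum_append, List.sum_cons] at this ⊢
    have e : L + x + a = L + a + x := by ring
    rw [e] at this
    obtain ⟨d, rfl⟩ := Nat.exists_eq_add_of_le hx
    obtain ⟨z, hz⟩ : ∃ z, s.sum + R = L + z := ⟨s.sum + R - L, by omega⟩
    -- With `d = a - x` and `z` the excess of `s.sum + R` over `L`, the right side exceeds the left
    -- by `d * (p.sum + z)`.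
    have e1 : L * (x + (p.sum + (x + d + s.sum)) + R) + (L + x) * (x + d + (p.sum + s.sum) + R) ≤
        L * (x + d + (x + (p.sum + s.sum)) + R) + (L + (x + d)) * (x + (p.sum + s.sum) + R) := by
      have : s.sum = L + z - R := by omega
      nlinarith [Nat.zero_le (d * z), Nat.zero_le (d * p.sum), congrArg (d * ·) hz]
    omega

/-- The same exchange towards the right: one adjacent swap first, then the induction hypothesis with
`x` absorbed into `p`. -/
theorem gapSum_move_right {L R a : ℕ} {p s : List ℕ} (ha : ∀ x ∈ s, x ≤ a)
    (h : s.sum + R ≤ L + p.sum) : gapSum L R (p ++ a :: s) ≤ gapSum L R (p ++ s ++ [a]) := by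
  induction s generalizing p with
  | nil => simp
  | cons x s ih =>
    have hx : x ≤ a := ha x (by simp)
    have key : gapSum L R (p ++ a :: x :: s) ≤ gapSum L R (p ++ x :: a :: s) := by
      clear ih
      induction p generalizing L with
      | nil =>
        simp only [List.nil_append, gapSum, List.sum_cons, List.sum_nil] at h ⊢
        rw [add_right_comm L a x]
        obtain ⟨d, rfl⟩ := Nat.exists_eq_add_of_le hx
        nlinarith [Nat.mul_le_mul_left d h]
      | cons b p ih =>
        simp only [List.cons_append, gapSum]
        have := ih (L := L + b) (by simp at h ⊢; omega)
        simp only [List.sum_append, List.sum_cons] at this ⊢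
        have e : p.sum + (a + (x + s.sum)) = p.sum + (x + (a + s.sum)) := by ring
        rw [e]; omega
    refine key.trans ?_
    have := ih (p := p ++ [x]) (fun y hy => ha y (by simp [hy])) (by simp at h ⊢; omega)
    simpa using this

/-- The head of `b` is the largest weight. Comparing the totals on its two sides shows to which end
it may be moved without loss; the rest is the same problem with that weight absorbed into `L` or
`R`. -/
theorem gapSum_le_bestGapSum {b : List ℕ} (hb : b.Pairwise (· ≥ ·)) (L R : ℕ) {l : List ℕ}
    (hl : l.Perm b) : gapSum L R l ≤ bestGapSum L R b := by
  induction b generalizing L R l with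
  | nil => rw [hl.eq_nil]; simp [gapSum, bestGapSum]
  | cons a b ih =>
    obtain ⟨hab, hb⟩ := List.pairwise_cons.1 hb
    obtain ⟨p, s, rfl⟩ := List.append_of_mem (hl.mem_iff.2 (List.mem_cons_self : a ∈ a :: b))
    have hps : (p ++ s).Perm b := (List.perm_middle.symm.trans hl).cons_inv
    have hle : ∀ x ∈ p ++ s, x ≤ a := fun x hx => hab x (hps.mem_iff.1 hx)
    rcases le_total (L + p.sum) (s.sum + R) with h | h
    · refine (gapSum_move_left (fun x hx => hle x (by simp [hx])) h).trans ?_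
      simp only [gapSum, bestGapSum, hps.sum_eq]
      exact le_max_of_le_left (Nat.add_le_add_left (ih hb _ _ hps) _)
    · refine (gapSum_move_right (fun x hx => hle x (by simp [hx])) h).trans ?_
      rw [gapSum_concat, bestGapSum]
      have := ih hb L (R + a) hps
      refine le_max_of_le_right ?_
      rw [hps.sum_eq]
      nlinarith

theorem bestArrangement_perm (L R : ℕ) (b : List ℕ) : (bestArrangement L R b).Perm b := by
  induction b generalizing L R with
  | nil => simp [bestArrangement]
  | cons a b ih =>
    rw [bestArrangement]
    split_ifs
    · exact (List.perm_append_singleton _ _).trans ((ih _ _).cons a)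
    · exact (ih _ _).cons a

theorem gapSum_bestArrangement (L R : ℕ) (b : List ℕ) :
    gapSum L R (bestArrangement L R b) = bestGapSum L R b := by
  induction b generalizing L R with
  | nil => simp [bestArrangement, gapSum, bestGapSum]
  | cons a b ih =>
    rw [bestArrangement, bestGapSum]
    split_ifs with h
    · rw [gapSum_concat, ih, (bestArrangement_perm _ _ b).sum_eq, max_eq_right h.le]; ring
    · rw [gapSum, ih, (bestArrangement_perm _ _ b).sum_eq, max_eq_left (not_lt.1 h)]

/-- There are `b.length + 1` gaps, and both factors at each are bounded by the total weight. This
feeds the word bound of the machine. -/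
theorem bestGapSum_le (L R : ℕ) (b : List ℕ) :
    bestGapSum L R b ≤ (b.length + 1) * (L + b.sum + R) ^ 2 := by
  induction b generalizing L R with
  | nil => simp [bestGapSum]; nlinarith
  | cons a b ih =>
    rw [bestGapSum]
    have h1 := ih (L + a) R
    have h2 := ih L (R + a)
    have e1 : L + a + b.sum + R = L + (a :: b).sum + R := by simp; ring
    have e2 : L + b.sum + (R + a) = L + (a :: b).sum + R := by simp; ring
    rw [e1] at h1; rw [e2] at h2
    have hs : (a :: b).sum = a + b.sum := by simp
    generalize hN : L + (a :: b).sum + R = N at *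
    simp only [List.length_cons]
    have h3 : L * (a + b.sum + R) ≤ N ^ 2 := by
      rw [sq]; exact Nat.mul_le_mul (by omega) (by omega)
    have h4 : R * (a + b.sum + L) ≤ N ^ 2 := by
      rw [sq]; exact Nat.mul_le_mul (by omega) (by omega)
    apply max_le <;> nlinarith

/-- Splitting one weight of the sequence into two adjacent ones. -/
theorem gapSum_split (L R : ℕ) (p s : List ℕ) (x z : ℕ) :
    gapSum L R (p ++ x :: z :: s) =
      gapSum L R (p ++ (x + z) :: s) + (L + p.sum + x) * (z + s.sum + R) := by
  induction p generalizing L with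
  | nil => simp only [List.nil_append, gapSum, List.sum_nil, List.sum_cons, ← add_assoc L x z]; ring
  | cons b p ih =>
    simp only [List.cons_append, gapSum, ih, List.sum_append, List.sum_cons]; ring

/-- A weight `z` that is not too large compared with those on one of the two sides can be split off
at a gain of at least `z` times the total of the other weights. -/
theorem exists_gapSum_split (p s : List ℕ) (x z : ℕ) (h : z ≤ p.sum + x ∨ z ≤ s.sum + x) :
    ∃ l : List ℕ, l.Perm (z :: x :: (p ++ s)) ∧
      gapSum 0 0 (p ++ (x + z) :: s) + z * (p.sum + x + s.sum) ≤ gapSum 0 0 l := by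
  rcases h with h | h
  · refine ⟨p ++ x :: z :: s, ?_, ?_⟩
    · refine (List.perm_middle.trans ((List.perm_middle).cons x)).trans (List.Perm.swap z x _)
    · rw [gapSum_split]
      nlinarith [Nat.mul_le_mul_right s.sum h]
  · refine ⟨p ++ z :: x :: s, ?_, ?_⟩
    · exact List.perm_middle.trans (List.perm_middle.cons z)
    · rw [gapSum_split, add_comm z x]
      nlinarith [Nat.mul_le_mul_right p.sum h]

/-! ### Distances in trees -/

section Distances

variable {V : Type*} {G : SimpleGraph V}

/-- A function that grows by at most 1 along edges bounds distances from below. Used for retractions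
and for the levels of the caterpillar. -/
theorem le_add_dist (hG : G.Connected) {f : V → ℕ} (hf : ∀ u v, G.Adj u v → f v ≤ f u + 1)
    (u v : V) : f v ≤ f u + G.dist u v := by
  obtain ⟨p, hp⟩ := hG.exists_walk_length_eq_dist u v
  rw [← hp]
  clear hp
  induction p with
  | nil => simp
  | cons h p ih =>
    have := hf _ _ h
    rw [SimpleGraph.Walk.length_cons]
    omega

/-- Uniqueness of the parent when the tree is rooted at `v`: extending a shortest walk from either
neighbour gives a path from `v` to `w`, and there is only one. -/
theorem eq_of_adj_of_dist_lt (hG : G.IsTree) {v w a b : V} (ha : G.Adj w a) (hb : G.Adj w b)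
    (hda : G.dist v a < G.dist v w) (hdb : G.dist v b < G.dist v w) : a = b := by
  have key : ∀ c, G.Adj w c → G.dist v c < G.dist v w →
      ∃ p : G.Walk v w, p.IsPath ∧ p.penultimate = c := by
    intro c hc hd
    obtain ⟨p, hp⟩ := hG.connected.exists_walk_length_eq_dist v c
    refine ⟨p.concat hc.symm, ?_, by simp⟩
    apply SimpleGraph.Walk.isPath_of_length_eq_dist
    rw [SimpleGraph.Walk.length_concat, hp]
    rcases hG.dist_eq_dist_add_one_of_adj v hc with h | h <;> omega
  obtain ⟨p, hp, rfl⟩ := key a ha hda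
  obtain ⟨q, hq, rfl⟩ := key b hb hdb
  rw [(hG.existsUnique_path v w).unique hp hq]

theorem exists_adj_dist_lt (hG : G.Connected) {v w : V} (h : w ≠ v) :
    ∃ a, G.Adj w a ∧ G.dist v a < G.dist v w := by
  obtain ⟨p, hp⟩ := hG.exists_walk_length_eq_dist w v
  cases p with
  | nil => exact absurd rfl h
  | cons hadj p =>
    refine ⟨_, hadj, ?_⟩
    rw [SimpleGraph.dist_comm, G.dist_comm (u := v), ← hp, SimpleGraph.Walk.length_cons]
    exact Nat.lt_succ_of_le (SimpleGraph.dist_le p)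

/-! ### The Wiener index through distances weighted by reduced degrees -/

-- Root the tree at `v`. Each of the other vertices has one edge to its parent; its lower end
-- contributes the vertex's own distance and its upper end that distance minus 1. Every edge arises
-- once in this way.
open Classical in
theorem sum_degree_mul_dist [Fintype V] (hG : G.IsTree) (v : V) :
    ∑ w, G.degree w * G.dist v w + Fintype.card V = 2 * ∑ w, G.dist v w + 1 := by
  have hcard : ∀ w, ∑ a, (if G.Adj w a ∧ G.dist v a < G.dist v w then 1 else 0) =
      if w = v then 0 else 1 := by
    intro w
    split_ifs with hw
    · subst hw; simp
    · obtain ⟨a, ha, hd⟩ := exists_adj_dist_lt hG.connected hw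
      rw [Finset.sum_eq_single a]
      · simp [ha, hd]
      · intro b _ hb
        rw [if_neg]
        rintro ⟨h1, h2⟩
        exact hb (eq_of_adj_of_dist_lt hG h1 ha h2 hd)
      · simp
  have h1 : ∑ w, G.degree w * G.dist v w = ∑ w, ∑ a, if G.Adj w a then G.dist v w else 0 := by
    refine Finset.sum_congr rfl fun w _ => ?_
    rw [← Finset.sum_filter, Finset.sum_const, smul_eq_mul, ← G.card_neighborFinset_eq_degree,
      G.neighborFinset_eq_filter]
  have h2 : ∑ w, ∑ a, (if G.Adj w a then G.dist v w else 0) =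
      ∑ w, ∑ a, (if G.Adj w a ∧ G.dist v a < G.dist v w then G.dist v w else 0) +
      ∑ w, ∑ a, (if G.Adj w a ∧ G.dist v w < G.dist v a then G.dist v w else 0) := by
    rw [← Finset.sum_add_distrib]
    refine Finset.sum_congr rfl fun w _ => ?_
    rw [← Finset.sum_add_distrib]
    refine Finset.sum_congr rfl fun a _ => ?_
    by_cases h : G.Adj w a
    · rcases hG.dist_eq_dist_add_one_of_adj v h with h' | h'
      · simp [h, h', show ¬ (G.dist v a + 1 < G.dist v a) by omega]
      · simp [h, h', show ¬ (G.dist v w + 1 < G.dist v w) by omega]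
    · simp [h]
  have h3 : ∑ w, ∑ a, (if G.Adj w a ∧ G.dist v a < G.dist v w then G.dist v w else 0) =
      ∑ w, G.dist v w := by
    refine Finset.sum_congr rfl fun w _ => ?_
    have : ∀ a, (if G.Adj w a ∧ G.dist v a < G.dist v w then G.dist v w else 0) =
        (if G.Adj w a ∧ G.dist v a < G.dist v w then 1 else 0) * G.dist v w := by
      intro a; split_ifs <;> simp
    rw [Finset.sum_congr rfl fun a _ => this a, ← Finset.sum_mul, hcard]
    split_ifs with hw
    · subst hw; simp
    · simp
  have h4 : ∑ w, ∑ a, (if G.Adj w a ∧ G.dist v w < G.dist v a then G.dist v w else 0) +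
      ∑ a, (if a = v then 0 else 1) = ∑ w, G.dist v w := by
    rw [Finset.sum_comm, ← h3, ← Finset.sum_congr rfl fun w _ => hcard w,
      ← Finset.sum_add_distrib]
    refine Finset.sum_congr rfl fun w _ => ?_
    rw [← Finset.sum_add_distrib]
    refine Finset.sum_congr rfl fun a _ => ?_
    rw [G.adj_comm]
    split_ifs with h
    · rcases hG.dist_eq_dist_add_one_of_adj v h.1 with h' | h' <;> omega
    · rfl
  have h5 : ∑ a, (if a = v then 0 else 1) + 1 = Fintype.card V := by
    have : ∑ a, ((if a = v then 0 else 1) + (if a = v then 1 else 0)) = Fintype.card V := by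
      rw [← Finset.card_univ, Finset.card_eq_sum_ones]
      exact Finset.sum_congr rfl fun a _ => by split_ifs <;> rfl
    rw [Finset.sum_add_distrib] at this
    simpa using this
  omega

open Classical in
theorem two_mul_wienerIndex [Fintype V] (G : SimpleGraph V) :
    2 * wienerIndex G = ∑ u, ∑ v, G.dist u v := by
  rw [wienerIndex, Finset.mul_sum, ← Finset.sum_product', Finset.univ_product_univ,
    ← Finset.sum_fiberwise (g := fun x : V × V => s(x.1, x.2))]
  refine Finset.sum_congr rfl fun p _ => ?_
  induction p using Sym2.ind with
  | _ a b =>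
    have : (Finset.univ.filter fun x : V × V => s(x.1, x.2) = s(a, b)) = {(a, b), (b, a)} := by
      ext ⟨x, y⟩; simp
    rw [this]
    by_cases h : a = b
    · subst h; simp
    · rw [Finset.sum_pair (by simp [h])]
      simp [G.dist_comm (u := b), two_mul]

open Classical in
/-- The Wiener index of a tree in terms of the distances weighted by the reduced degrees. -/
theorem wienerIndex_eq_weighted [Fintype V] (hG : G.IsTree) {y : V → ℕ}
    (hy : ∀ v, G.degree v = y v + 1) :
    2 * wienerIndex G =
      2 * (Fintype.card V - 1) ^ 2 + ∑ u, ∑ v, y u * y v * G.dist u v := by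
  rw [two_mul_wienerIndex]
  have hne : Nonempty V := hG.connected.nonempty
  obtain ⟨n, hn⟩ : ∃ n, Fintype.card V = n + 1 := Nat.exists_eq_succ_of_ne_zero Fintype.card_ne_zero
  have h1 : ∀ v, ∑ w, y w * G.dist v w + n = ∑ w, G.dist v w := by
    intro v
    have := sum_degree_mul_dist hG v
    simp only [hy, add_mul, one_mul, Finset.sum_add_distrib, hn] at this
    omega
  have h2 : ∑ v, y v + 2 = n + 1 := by
    have := hG.card_edgeFinset
    have h' := G.sum_degrees_eq_twice_card_edges
    simp only [hy, Finset.sum_add_distrib, Finset.sum_const, Finset.card_univ, smul_eq_mul, hn] at *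
    omega
  -- The identity `h1` is applied at one end of the pairs here and at the other end in `h4`; `h2`
  -- makes the error terms constant.
  have h3 : ∑ u, ∑ v, y u * y v * G.dist u v + (∑ v, y v) * n = ∑ u, y u * ∑ v, G.dist u v := by
    rw [Finset.sum_mul, ← Finset.sum_add_distrib]
    refine Finset.sum_congr rfl fun u _ => ?_
    rw [← h1, mul_add, Finset.mul_sum]
    simp only [mul_assoc]
  have h4 : ∑ u, y u * ∑ v, G.dist u v + (n + 1) * n = ∑ u, ∑ v, G.dist u v := by
    have : ∑ u, y u * ∑ v, G.dist u v = ∑ v, ∑ u, y u * G.dist v u := by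
      rw [Finset.sum_comm]
      refine Finset.sum_congr rfl fun u _ => ?_
      rw [Finset.mul_sum]
      exact Finset.sum_congr rfl fun v _ => by rw [G.dist_comm]
    rw [this, ← Finset.sum_congr rfl fun v _ => h1 v, Finset.sum_add_distrib]
    simp [hn]
  rw [hn, Nat.add_sub_cancel, ← h4, ← h3]
  obtain ⟨m, rfl⟩ : ∃ m, n = m + 1 := ⟨n - 1, by omega⟩
  have : ∑ v, y v = m := by omega
  rw [this]; ring

end Distances

/-! ### Paths maximize the weighted sum of distances -/

section Contraction

variable {V : Type*} {G : SimpleGraph V} {ℓ u : V}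

/-- Sending the leaf `ℓ` to its only neighbour retracts the graph onto the complement without
stretching edges, so deleting `ℓ` does not lengthen distances. -/
theorem dist_induce_compl_singleton (hG : G.Connected) (hG' : (G.induce {ℓ}ᶜ).Connected)
    (hu : G.Adj ℓ u) (huniq : ∀ w, G.Adj ℓ w → w = u) (a b : ({ℓ}ᶜ : Set V)) :
    (G.induce {ℓ}ᶜ).dist a b = G.dist a b := by
  classical
  apply le_antisymm
  · let ρ : V → ({ℓ}ᶜ : Set V) := fun x => if h : x = ℓ then ⟨u, hu.ne'⟩ else ⟨x, h⟩
    have hρ : ∀ x : ({ℓ}ᶜ : Set V), ρ x = x := fun x => dif_neg x.2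
    have hstep : ∀ v w, G.Adj v w →
        (G.induce {ℓ}ᶜ).dist a (ρ w) ≤ (G.induce {ℓ}ᶜ).dist a (ρ v) + 1 := by
      intro v w hvw
      have hd : (G.induce {ℓ}ᶜ).dist (ρ v) (ρ w) ≤ 1 := by
        by_cases hv : v = ℓ
        · subst hv
          have : w = u := huniq w hvw
          subst this
          simp [ρ, hvw.ne']
        by_cases hw : w = ℓ
        · subst hw
          have : v = u := huniq v hvw.symm
          subst this
          simp [ρ, hv]
        · refine (SimpleGraph.dist_eq_one_iff_adj.2 ?_).le
          simpa [ρ, hv, hw] using hvw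
      exact (hG'.dist_triangle (v := ρ v)).trans (Nat.add_le_add_left hd _)
    have := le_add_dist hG hstep a b
    simpa [hρ] using this
  · have hstep : ∀ v w : ({ℓ}ᶜ : Set V), (G.induce {ℓ}ᶜ).Adj v w →
        G.dist a w ≤ G.dist a v + 1 := by
      intro v w hvw
      have h1 : G.dist v w = 1 := SimpleGraph.dist_eq_one_iff_adj.2 hvw
      have := hG.dist_triangle (u := (a : V)) (v := v) (w := w)
      omega
    have := le_add_dist (f := fun x : ({ℓ}ᶜ : Set V) => G.dist a x) hG' hstep a b
    simpa using this

theorem dist_leaf (hG : G.IsTree) (hu : G.Adj ℓ u) (huniq : ∀ w, G.Adj ℓ w → w = u) {b : V}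
    (hb : b ≠ ℓ) : G.dist ℓ b = G.dist u b + 1 := by
  obtain ⟨a, ha, hd⟩ := exists_adj_dist_lt hG.connected hb.symm
  obtain rfl := huniq a ha
  rw [G.dist_comm, G.dist_comm (u := a)]
  rcases hG.dist_eq_dist_add_one_of_adj b ha with h | h <;> omega

theorem sum_eq_add_sum_compl_singleton [Fintype V] [DecidableEq V] (ℓ : V) (f : V → ℕ) :
    ∑ x, f x = f ℓ + ∑ x : ({ℓ}ᶜ : Set V), f x := by
  rw [← Finset.add_sum_erase _ _ (Finset.mem_univ ℓ)]
  congr 1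
  exact (Finset.sum_subtype _ (by simp) _)

/-- The leaf is one step farther than `u` from every other vertex. Moving its weight to `u`
therefore loses `y ℓ * y b` for each other `b`, in both orders of the pair. -/
theorem sum_weighted_dist_contract [Fintype V] [DecidableEq V] (hG : G.IsTree)
    (hG' : (G.induce {ℓ}ᶜ).Connected)
    (hu : G.Adj ℓ u) (huniq : ∀ w, G.Adj ℓ w → w = u) (y : V → ℕ) :
    ∑ a, ∑ b, y a * y b * G.dist a b =
      ∑ a : ({ℓ}ᶜ : Set V), ∑ b : ({ℓ}ᶜ : Set V),
        (y a + if (a : V) = u then y ℓ else 0) * (y b + if (b : V) = u then y ℓ else 0) *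
          (G.induce {ℓ}ᶜ).dist a b + 2 * (y ℓ * ∑ b : ({ℓ}ᶜ : Set V), y b) := by
  obtain ⟨u', hu'⟩ : ∃ x : ({ℓ}ᶜ : Set V), (x : V) = u := ⟨⟨u, hu.ne'⟩, rfl⟩
  have hif : ∀ a : ({ℓ}ᶜ : Set V), ((a : V) = u) = (a = u') := by
    intro a; rw [← hu', Subtype.ext_iff]
  have hpush : ∀ g : ({ℓ}ᶜ : Set V) → ℕ,
      ∑ a : ({ℓ}ᶜ : Set V), (y a + if (a : V) = u then y ℓ else 0) * g a =
        ∑ a : ({ℓ}ᶜ : Set V), y a * g a + y ℓ * g u' := by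
    intro g
    simp only [add_mul, Finset.sum_add_distrib, hif, ite_mul, zero_mul]
    simp
  have h1 : ∑ a : ({ℓ}ᶜ : Set V), ∑ b : ({ℓ}ᶜ : Set V),
        (y a + if (a : V) = u then y ℓ else 0) * (y b + if (b : V) = u then y ℓ else 0) *
          (G.induce {ℓ}ᶜ).dist a b =
      ∑ a : ({ℓ}ᶜ : Set V), ∑ b : ({ℓ}ᶜ : Set V), y a * y b * G.dist a b +
        2 * (y ℓ * ∑ b : ({ℓ}ᶜ : Set V), y b * G.dist u b) := by
    simp only [mul_assoc, ← Finset.mul_sum, hpush,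
      dist_induce_compl_singleton hG.connected hG' hu huniq]
    simp only [mul_add, Finset.sum_add_distrib]
    rw [hu', SimpleGraph.dist_self, two_mul, mul_zero, mul_zero, add_zero, add_assoc]
    congr 2
    rw [Finset.mul_sum]
    exact Finset.sum_congr rfl fun x _ => by rw [G.dist_comm]; ring
  rw [h1, sum_eq_add_sum_compl_singleton ℓ]
  simp only [sum_eq_add_sum_compl_singleton ℓ (fun b => y _ * y b * _), Finset.sum_add_distrib,
    SimpleGraph.dist_self, mul_zero, zero_add]
  have h2 : ∀ x : ({ℓ}ᶜ : Set V), G.dist ℓ x = G.dist u x + 1 := fun x => dist_leaf hG hu huniq x.2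
  have h3 : ∑ x : ({ℓ}ᶜ : Set V), y ℓ * y x * G.dist ℓ x =
      y ℓ * ∑ b : ({ℓ}ᶜ : Set V), y b * G.dist u b + y ℓ * ∑ b : ({ℓ}ᶜ : Set V), y b := by
    rw [Finset.mul_sum, Finset.mul_sum, ← Finset.sum_add_distrib]
    exact Finset.sum_congr rfl fun x _ => by rw [h2]; ring
  have h4 : ∑ x : ({ℓ}ᶜ : Set V), y x * y ℓ * G.dist x ℓ =
      ∑ x : ({ℓ}ᶜ : Set V), y ℓ * y x * G.dist ℓ x :=
    Finset.sum_congr rfl fun x _ => by rw [G.dist_comm]; ring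
  rw [h4, h3]; ring

end Contraction

/-- `l` lists the nonzero values of `y`. -/
def ListsNonzero {V : Type*} [Fintype V] (l : List ℕ) (y : V → ℕ) : Prop :=
  0 ∉ l ∧ ∀ φ : ℕ → ℕ, φ 0 = 0 → (l.map φ).sum = ∑ v, φ (y v)

theorem ListsNonzero.mem_iff {V : Type*} [Fintype V] {l : List ℕ} {y : V → ℕ}
    (h : ListsNonzero l y) {v : V} (hv : y v ≠ 0) : y v ∈ l := by
  by_contra hmem
  have := h.2 (fun n => if n = y v then 1 else 0) (by simp [hv.symm])
  rw [List.sum_eq_zero] at this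
  · have h' := (Finset.sum_eq_zero_iff.1 this.symm) v (Finset.mem_univ v)
    simp at h'
  · intro x hx
    obtain ⟨n, hn, rfl⟩ := List.mem_map.1 hx
    rw [if_neg]
    rintro rfl
    exact hmem hn

theorem exists_list_of_function {V : Type*} [Fintype V] (y : V → ℕ) :
    ∃ l : List ℕ, ListsNonzero l y := by
  refine ⟨(Finset.univ.toList.map y).filter (· ≠ 0), by simp, fun φ hφ => ?_⟩
  have : ∀ l : List ℕ, ((l.filter (· ≠ 0)).map φ).sum = (l.map φ).sum := by
    intro l
    induction l with
    | nil => simp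
    | cons a l ih =>
      by_cases ha : a = 0
      · simp [ha, hφ] at ih ⊢; exact ih
      · simp [ha] at ih ⊢; exact ih
  rw [this, List.map_map]
  exact Finset.sum_map_toList _ _

/-- For weights on the vertices of a tree such that only leaves may have weight zero, some
arrangement of the nonzero weights on a path has a weighted sum of distances at least as large. -/
theorem exists_gapSum_ge_of_isTree {V : Type*} [Fintype V] {G : SimpleGraph V} (hG : G.IsTree)
    (y : V → ℕ) (hy : ∀ v, y v = 0 → ∀ a b, G.Adj v a → G.Adj v b → a = b) :
    ∃ l : List ℕ, ListsNonzero l y ∧ ∑ a, ∑ b, y a * y b * G.dist a b ≤ 2 * gapSum 0 0 l := by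
  classical
  induction hn : Fintype.card V generalizing V with
  | zero => exact absurd hn (@Fintype.card_ne_zero V _ hG.connected.nonempty)
  | succ n ih =>
    rcases subsingleton_or_nontrivial V with hV | hV
    · obtain ⟨l, hl⟩ := exists_list_of_function y
      refine ⟨l, hl, ?_⟩
      have : ∀ a b : V, G.dist a b = 0 := fun a b => by
        rw [Subsingleton.elim a b, SimpleGraph.dist_self]
      simp [this]
    obtain ⟨a, b, hab, ha, hb⟩ := hG.exists_ne_and_degree_eq_one
    -- Minimality of the leaf is what later makes a second leaf `m` heavy enough for the split.
    obtain ⟨ℓ, hℓ, hmin⟩ := Finset.exists_min_image (Finset.univ.filter fun v => G.degree v = 1) y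
      ⟨a, by simpa using ha⟩
    simp only [Finset.mem_filter, Finset.mem_univ, true_and] at hℓ hmin
    obtain ⟨m, hmℓ, hm⟩ : ∃ m, m ≠ ℓ ∧ G.degree m = 1 := by
      by_cases h : a = ℓ
      · exact ⟨b, fun h' => hab (h.trans h'.symm), hb⟩
      · exact ⟨a, h, ha⟩
    have hG' := hG.connected.induce_compl_singleton_of_degree_eq_one hℓ
    obtain ⟨u, hu, huniq⟩ := SimpleGraph.degree_eq_one_iff_existsUnique_adj.1 hℓ
    obtain ⟨u', hu'⟩ : ∃ x : ({ℓ}ᶜ : Set V), (x : V) = u := ⟨⟨u, hu.ne'⟩, rfl⟩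
    let y' : ({ℓ}ᶜ : Set V) → ℕ := fun x => y x + if (x : V) = u then y ℓ else 0
    obtain ⟨l, hl, hle⟩ := ih (G := G.induce {ℓ}ᶜ) ⟨hG', hG.isAcyclic.induce _⟩ y'
      (by
        intro v hv a b h1 h2
        have : y v = 0 := by simp only [y'] at hv; omega
        exact Subtype.ext (hy v this a b h1 h2))
      (by
        have := Fintype.card_subtype_compl (fun x => x = ℓ)
        rw [Fintype.card_subtype_eq, hn] at this
        exact this)
    have hsum := sum_weighted_dist_contract hG hG' hu huniq y
    have hφ : ∀ φ : ℕ → ℕ, ∑ v, φ (y' v) + φ (y ℓ) + φ (y u) = ∑ v, φ (y v) + φ (y u + y ℓ) := by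
      intro φ
      have h1 := sum_eq_add_sum_compl_singleton ℓ fun v => φ (y v)
      have h2 := Finset.add_sum_erase Finset.univ (fun v => φ (y' v)) (Finset.mem_univ u')
      have h3 := Finset.add_sum_erase Finset.univ (fun v : ({ℓ}ᶜ : Set V) => φ (y v))
        (Finset.mem_univ u')
      have h4 : ∑ v ∈ Finset.univ.erase u', φ (y' v) = ∑ v ∈ Finset.univ.erase u', φ (y v) := by
        refine Finset.sum_congr rfl fun v hv => ?_
        have : (v : V) ≠ u := fun h => (Finset.ne_of_mem_erase hv) (Subtype.ext (h.trans hu'.symm))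
        simp [y', this]
      have h5 : y' u' = y u + y ℓ := by simp [y', hu']
      simp only [h5] at h2
      rw [hu'] at h3
      omega
    by_cases h0 : y ℓ = 0
    · refine ⟨l, ⟨hl.1, fun φ h => ?_⟩, ?_⟩
      · have := hφ φ
        rw [h0, h, add_zero, add_zero] at this
        rw [hl.2 φ h]; omega
      · rw [hsum, h0]
        simpa [y', h0] using hle
    -- If `u` had weight 0, it would itself be a leaf, and a lighter one than `ℓ`.
    have hu0 : y u ≠ 0 := by
      intro h
      have : G.degree u = 1 :=
        SimpleGraph.degree_eq_one_iff_existsUnique_adj.2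
          ⟨ℓ, hu.symm, fun w hw => hy u h w ℓ hw hu.symm⟩
      have := hmin u this
      omega
    have hmem : y u + y ℓ ∈ l := by
      have h5 : y' u' = y u + y ℓ := by simp [y', hu']
      rw [← h5]
      exact hl.mem_iff (by omega)
    obtain ⟨p, s, rfl⟩ := List.append_of_mem hmem
    have hps : ∀ φ : ℕ → ℕ, φ 0 = 0 →
        ((p ++ s).map φ).sum + φ (y ℓ) + φ (y u) = ∑ v, φ (y v) := by
      intro φ h
      have h1 := hl.2 φ h
      have h2 := hφ φ
      simp only [List.map_append, List.map_cons, List.sum_append, List.sum_cons] at h1 ⊢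
      omega
    have hsplit : y ℓ ≤ p.sum + y u ∨ y ℓ ≤ s.sum + y u := by
      have hle := hmin m hm
      by_cases hmu : m = u
      · subst hmu; left; omega
      -- The vertices `m`, `ℓ`, `u` are distinct, and `p ++ s` lists all nonzero weights except
      -- those of `ℓ` and `u`; otherwise the value `y m` would be counted once too few.
      have hm' : y m ∈ p ++ s := by
        by_contra hnot
        have h1 := hps (fun n => if n = y m then 1 else 0) (by simp; omega)
        have h2 : ((p ++ s).map fun n => if n = y m then 1 else 0).sum = 0 := by
          apply List.sum_eq_zero
          intro x hx
          obtain ⟨n, hn, rfl⟩ := List.mem_map.1 hx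
          rw [if_neg]
          rintro rfl
          exact hnot hn
        have h3 : ∑ v ∈ {m, ℓ, u}, (if y v = y m then 1 else 0) ≤
            ∑ v, (if y v = y m then 1 else 0) :=
          Finset.sum_le_sum_of_subset (Finset.subset_univ _)
        rw [Finset.sum_insert (by simp [hmℓ, hmu]), Finset.sum_pair hu.ne, if_pos rfl] at h3
        omega
      rcases List.mem_append.1 hm' with h | h
      · left; have := List.le_sum_of_mem h; omega
      · right; have := List.le_sum_of_mem h; omega
    obtain ⟨l', hperm, hgap⟩ := exists_gapSum_split p s (y u) (y ℓ) hsplit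
    refine ⟨l', ⟨?_, fun φ h => ?_⟩, ?_⟩
    · rw [hperm.mem_iff]
      have := hl.1
      simp only [List.mem_append, List.mem_cons, not_or] at this ⊢
      exact ⟨fun h => h0 h.symm, fun h => hu0 h.symm, this.1, this.2.2⟩
    · rw [(hperm.map φ).sum_eq, ← hps φ h]
      simp only [List.map_cons, List.sum_cons]; ring
    · have h1 := hps id rfl
      have h2 := sum_eq_add_sum_compl_singleton ℓ y
      have h3 : ∑ b : ({ℓ}ᶜ : Set V), y b = p.sum + y u + s.sum := by
        simp only [List.map_id, id, List.sum_append] at h1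
        omega
      rw [hsum, h3]
      refine le_trans (Nat.add_le_add_right hle _) ?_
      omega

/-! ### Functions with the same nonzero values -/

section ListsNonzero

variable {V₁ V₂ : Type*} [Fintype V₁] [Fintype V₂] {l l₁ l₂ : List ℕ} {y₁ : V₁ → ℕ} {y₂ : V₂ → ℕ}

theorem ListsNonzero.comp_equiv (h : ListsNonzero l y₁) (e : V₂ ≃ V₁) :
    ListsNonzero l fun v => y₁ (e v) :=
  ⟨h.1, fun φ hφ => (h.2 φ hφ).trans (Equiv.sum_comp e fun v => φ (y₁ v)).symm⟩

theorem ListsNonzero.of_perm (h : ListsNonzero l₁ y₁) (hp : l₂.Perm l₁) : ListsNonzero l₂ y₁ :=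
  ⟨fun h0 => h.1 (hp.mem_iff.1 h0), fun φ hφ => (hp.map φ).sum_eq.trans (h.2 φ hφ)⟩

theorem sum_map_ite_eq (l : List ℕ) (c : ℕ) :
    (l.map fun n => if n = c then 1 else 0).sum = l.count c := by
  induction l with
  | nil => simp
  | cons a l ih =>
    rw [List.map_cons, List.sum_cons, ih, List.count_cons, add_comm]
    simp

/-- Indicator functions of nonzero values recover all multiplicities from the sums in
`ListsNonzero`. -/
theorem ListsNonzero.perm (h₁ : ListsNonzero l₁ y₁) (h₂ : ListsNonzero l₂ y₁) : l₁.Perm l₂ := by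
  refine List.perm_iff_count.2 fun c => ?_
  by_cases hc : c = 0
  · subst hc
    rw [List.count_eq_zero_of_not_mem h₁.1, List.count_eq_zero_of_not_mem h₂.1]
  · rw [← sum_map_ite_eq, ← sum_map_ite_eq]
    exact (h₁.2 (fun n => if n = c then 1 else 0) (if_neg (Ne.symm hc))).trans
      (h₂.2 (fun n => if n = c then 1 else 0) (if_neg (Ne.symm hc))).symm

/-- Fibres over nonzero values have equal size by the shared list; the fibres over 0 then do because
the cardinalities agree. A bijection is glued from the fibres. -/
theorem ListsNonzero.exists_equiv (h₁ : ListsNonzero l y₁) (h₂ : ListsNonzero l y₂)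
    (hcard : Fintype.card V₁ = Fintype.card V₂) : ∃ e : V₁ ≃ V₂, ∀ v, y₂ (e v) = y₁ v := by
  classical
  have hpos : ∀ c ≠ 0, ∑ v, (if y₁ v = c then 1 else 0) = ∑ v, (if y₂ v = c then 1 else 0) := by
    intro c hc
    exact (h₁.2 (fun n => if n = c then 1 else 0) (if_neg (Ne.symm hc))).symm.trans
      (h₂.2 (fun n => if n = c then 1 else 0) (if_neg (Ne.symm hc)))
  have hne : ∑ v, (if y₁ v = 0 then 0 else 1) = ∑ v, (if y₂ v = 0 then 0 else 1) :=
    (h₁.2 (fun n => if n = 0 then 0 else 1) (if_pos rfl)).symm.trans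
      (h₂.2 (fun n => if n = 0 then 0 else 1) (if_pos rfl))
  have hall : ∀ c, ∑ v, (if y₁ v = c then 1 else 0) = ∑ v, (if y₂ v = c then 1 else 0) := by
    intro c
    by_cases hc : c = 0
    · subst hc
      have e1 : ∑ v, (if y₁ v = 0 then 1 else 0) + ∑ v, (if y₁ v = 0 then 0 else 1) =
          Fintype.card V₁ := by
        rw [← Finset.sum_add_distrib, ← Finset.card_univ, Finset.card_eq_sum_ones]
        exact Finset.sum_congr rfl fun v _ => by split_ifs <;> rfl
      have e2 : ∑ v, (if y₂ v = 0 then 1 else 0) + ∑ v, (if y₂ v = 0 then 0 else 1) =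
          Fintype.card V₂ := by
        rw [← Finset.sum_add_distrib, ← Finset.card_univ, Finset.card_eq_sum_ones]
        exact Finset.sum_congr rfl fun v _ => by split_ifs <;> rfl
      omega
    · exact hpos c hc
  have hfib : ∀ c, Nonempty ({v // y₁ v = c} ≃ {v // y₂ v = c}) := by
    intro c
    refine Fintype.card_eq.1 ?_
    have := hall c
    rw [← Finset.sum_filter, ← Finset.sum_filter, ← Finset.card_eq_sum_ones,
      ← Finset.card_eq_sum_ones] at this
    rw [Fintype.card_subtype, Fintype.card_subtype, this]
  exact ⟨Equiv.ofFiberEquiv fun c => (hfib c).some, fun v => Equiv.ofFiberEquiv_map _ v⟩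

end ListsNonzero

/-! ### Graphs given by a parent function -/

/-- The graph on `0, …, r - 1` in which every vertex `v ≠ 0` is joined to `p v`. -/
def parentGraph (r : ℕ) (p : ℕ → ℕ) : SimpleGraph (Fin r) where
  Adj u v := u ≠ v ∧ ((u.1 ≠ 0 ∧ p u = v) ∨ (v.1 ≠ 0 ∧ p v = u))
  symm := ⟨fun _ _ h => ⟨h.1.symm, h.2.symm⟩⟩
  loopless := ⟨fun _ h => h.1 rfl⟩

section ParentGraph

variable {r : ℕ} {p : ℕ → ℕ}

theorem parentGraph_adj (hp : ∀ v, v ≠ 0 → p v < v) {u v : Fin r} :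
    (parentGraph r p).Adj u v ↔ (u.1 ≠ 0 ∧ p u = v) ∨ (v.1 ≠ 0 ∧ p v = u) := by
  refine ⟨fun h => h.2, fun h => ⟨?_, h⟩⟩
  rintro rfl
  rcases h with h | h <;> exact absurd h.2 (hp _ h.1).ne

theorem parentGraph_connected (hp : ∀ v, v ≠ 0 → p v < v) (hr : 0 < r) :
    (parentGraph r p).Connected := by
  have key : ∀ n (h : n < r), (parentGraph r p).Reachable ⟨n, h⟩ ⟨0, hr⟩ := by
    intro n
    induction n using Nat.strong_induction_on with
    | _ n ih =>
      intro h
      by_cases h0 : n = 0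
      · subst h0; exact SimpleGraph.Reachable.refl _
      · have hlt := hp n h0
        refine SimpleGraph.Reachable.trans ?_ (ih (p n) hlt (hlt.trans h))
        exact ((parentGraph_adj hp).2 (Or.inl ⟨h0, rfl⟩)).reachable
  exact SimpleGraph.connected_iff_exists_forall_reachable _ |>.2
    ⟨⟨0, hr⟩, fun v => (key v v.2).symm⟩

/-- Mapping an edge to its child end is injective into the vertices other than 0, so a connected
graph has the number of edges of a tree. -/
theorem parentGraph_isTree (hp : ∀ v, v ≠ 0 → p v < v) (hr : 0 < r) :
    (parentGraph r p).IsTree := by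
  classical
  have hc := parentGraph_connected hp hr
  refine SimpleGraph.isTree_iff_connected_and_card.2 ⟨hc, ?_⟩
  refine le_antisymm ?_ hc.card_vert_le_card_edgeSet_add_one
  have hex : ∀ e : (parentGraph r p).edgeSet, ∃ v : {v : Fin r // v.1 ≠ 0},
      e.1 = s(v.1, ⟨p v.1, (hp _ v.2).trans v.1.2⟩) := by
    rintro ⟨e, he⟩
    induction e using Sym2.ind with
    | _ a b =>
      rcases (parentGraph_adj hp).1 he with h | h
      · exact ⟨⟨a, h.1⟩, by simp [h.2]⟩
      · exact ⟨⟨b, h.1⟩, by simp [h.2, Sym2.eq_swap]⟩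
  choose f hf using hex
  have hinj : Function.Injective f := by
    intro e e' h
    apply Subtype.ext
    rw [hf e, hf e', h]
  have h1 := Nat.card_le_card_of_injective f hinj
  have h2 : Nat.card {v : Fin r // v.1 ≠ 0} = r - 1 := by
    have e1 := Fintype.card_subtype_compl fun v : Fin r => v = ⟨0, hr⟩
    rw [Fintype.card_subtype_eq, Fintype.card_fin] at e1
    rw [Nat.card_eq_fintype_card, ← e1]
    exact Fintype.card_congr (Equiv.subtypeEquivRight fun v => by simp [Fin.ext_iff])
  rw [h2] at h1
  rw [Nat.card_eq_fintype_card (α := Fin r), Fintype.card_fin]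
  omega

open Classical in
theorem parentGraph_degree (hp : ∀ v, v ≠ 0 → p v < v) (u : Fin r) :
    (parentGraph r p).degree u =
      (if u.1 = 0 then 0 else 1) + ∑ v : Fin r, if v.1 ≠ 0 ∧ p v = u then 1 else 0 := by
  rw [← SimpleGraph.card_neighborFinset_eq_degree, SimpleGraph.neighborFinset_eq_filter,
    Finset.card_filter]
  have h1 : ∑ v : Fin r, (if u.1 ≠ 0 ∧ p u = v then 1 else 0) = if u.1 = 0 then 0 else 1 := by
    split_ifs with h
    · simp [h]
    · rw [Finset.sum_eq_single (⟨p u, (hp _ h).trans u.2⟩ : Fin r)]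
      · simp [h]
      · intro b _ hb
        rw [if_neg]
        rintro ⟨-, h'⟩
        exact hb (Fin.ext h'.symm)
      · simp
  rw [← h1, ← Finset.sum_add_distrib]
  refine Finset.sum_congr rfl fun v _ => ?_
  rw [parentGraph_adj hp]
  by_cases ha : u.1 ≠ 0 ∧ p u = v
  · have hb : ¬ (v.1 ≠ 0 ∧ p v = u) := by
      rintro ⟨h2, h3⟩
      have := hp _ h2
      have := hp _ ha.1
      omega
    simp [ha, hb]
  · simp [ha]

end ParentGraph

/-! ### Caterpillars -/

/-- The list of the numbers `c, c + l₀, c + l₀ + l₁, …`, one for each entry of `l`. -/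
def starts (c : ℕ) : List ℕ → List ℕ
  | [] => []
  | a :: l => c :: starts (c + a) l

/-- `c` repeated `l₀` times, then `c + l₀` repeated `l₁` times, and so on. -/
def spine (c : ℕ) : List ℕ → List ℕ
  | [] => []
  | a :: l => List.replicate a c ++ spine (c + a) l

/-- `k` repeated `l₀` times, then `k + 1` repeated `l₁` times, and so on. -/
def levels (k : ℕ) : List ℕ → List ℕ
  | [] => []
  | a :: l => List.replicate a k ++ levels (k + 1) l

/-- The predecessor of the last marked number up to `v`. -/
def parent (mark : ℕ → ℕ) : ℕ → ℕ
  | 0 => 0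
  | v + 1 => if 0 < mark (v + 1) then v else parent mark v

/-- The number of marked positive numbers up to `v`. -/
def level (mark : ℕ → ℕ) : ℕ → ℕ
  | 0 => 0
  | v + 1 => if 0 < mark (v + 1) then level mark v + 1 else level mark v

theorem parent_lt (mark : ℕ → ℕ) (v : ℕ) (hv : v ≠ 0) : parent mark v < v := by
  induction v with
  | zero => exact absurd rfl hv
  | succ v ih =>
    rw [parent]
    split_ifs
    · omega
    · rcases Nat.eq_zero_or_pos v with h | h
      · subst h; simp [parent]
      · have := ih h.ne'; omega

/-- Makes `level` change by at most 1 along edges of the parent graph. -/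
theorem level_parent (mark : ℕ → ℕ) (v : ℕ) :
    level mark (parent mark v) ≤ level mark v ∧
      level mark v ≤ level mark (parent mark v) + 1 := by
  induction v with
  | zero => simp [parent, level]
  | succ v ih =>
    rw [parent, level]
    split_ifs
    · omega
    · exact ih

theorem le_of_mem_starts {c x : ℕ} {l : List ℕ} (h : x ∈ starts c l) : c ≤ x := by
  induction l generalizing c with
  | nil => simp [starts] at h
  | cons a l ih =>
    rcases List.mem_cons.1 h with h | h
    · omega
    · have := ih h; omega

theorem parent_level_block {mark : ℕ → ℕ} {c a : ℕ} (h0 : 0 < mark (c + 1))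
    (h : ∀ v, c + 1 < v → v ≤ c + a → ¬ 0 < mark v) {j : ℕ} (hj : j < a) :
    parent mark (c + 1 + j) = c ∧ level mark (c + 1 + j) = level mark c + 1 := by
  induction j with
  | zero => simp [parent, level, h0]
  | succ j ih =>
    have hm := h (c + 1 + j + 1) (by omega) (by omega)
    have := ih (by omega)
    rw [← add_assoc, parent, level, if_neg hm, if_neg hm]
    exact this

/-- The children of a spine vertex are the consecutive numbers of one block, and the last of them is
the next spine vertex. So the parents in order form `spine`, and levels along the spine increase by
one per block. -/
theorem map_parent_range' {mark : ℕ → ℕ} {c : ℕ} {l : List ℕ} (hl : 0 ∉ l)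
    (hm : ∀ v, c + 1 ≤ v → v ≤ c + l.sum → (0 < mark v ↔ v ∈ starts (c + 1) l)) :
    (List.range' (c + 1) l.sum).map (parent mark) = spine c l ∧
      (spine c l).map (level mark) = levels (level mark c) l := by
  induction l generalizing c with
  | nil => simp [spine, levels]
  | cons a l ih =>
    have ha : 0 < a := Nat.pos_of_ne_zero fun h => hl (by simp [h])
    have hs : (a :: l).sum = a + l.sum := List.sum_cons
    have h0 : 0 < mark (c + 1) :=
      (hm (c + 1) le_rfl (by omega)).2 (by simp [starts])
    have hb : ∀ v, c + 1 < v → v ≤ c + a → ¬ 0 < mark v := by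
      intro v h1 h2 h3
      rcases List.mem_cons.1 ((hm v h1.le (by omega)).1 h3) with h | h
      · omega
      · have := le_of_mem_starts h; omega
    have hblock : ∀ j, j < a → parent mark (c + 1 + j) = c ∧
        level mark (c + 1 + j) = level mark c + 1 := fun j hj => parent_level_block h0 hb hj
    have hnext := ih (c := c + a) (fun h => hl (by simp [h])) (by
      intro v h1 h2
      rw [hm v (by omega) (by omega), starts, List.mem_cons, add_right_comm c 1 a]
      constructor
      · rintro (h | h)
        · omega
        · exact h
      · exact Or.inr)
    constructor
    · rw [hs, ← List.range'_append_1, List.map_append, spine, add_right_comm c 1 a, hnext.1]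
      congr 1
      refine List.eq_replicate_iff.2 ⟨by simp, ?_⟩
      intro x hx
      obtain ⟨v, hv, rfl⟩ := List.mem_map.1 hx
      rw [List.mem_range'_1] at hv
      obtain ⟨j, rfl⟩ := Nat.exists_eq_add_of_le hv.1
      exact (hblock j (by omega)).1
    · have hla : level mark (c + a) = level mark c + 1 := by
        have := (hblock (a - 1) (by omega)).2
        rwa [show c + 1 + (a - 1) = c + a by omega] at this
      rw [spine, List.map_append, hnext.2, hla, levels, List.map_replicate]

theorem lt_of_mem_spine {c x : ℕ} {l : List ℕ} (hl : 0 ∉ l) (h : x ∈ spine c l) :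
    c ≤ x ∧ x < c + l.sum := by
  induction l generalizing c with
  | nil => simp [spine] at h
  | cons a l ih =>
    have ha : 0 < a := Nat.pos_of_ne_zero fun h => hl (by simp [h])
    rw [List.sum_cons]
    rcases List.mem_append.1 h with h | h
    · have := List.eq_of_mem_replicate h; omega
    · have := ih (fun h => hl (by simp [h])) h; omega

/-- Without zero entries the spine vertices are distinct, so their multiplicities are the entries of
`l` and all other numbers have multiplicity 0. -/
theorem sum_count_spine (φ : ℕ → ℕ) (hφ : φ 0 = 0) {c : ℕ} {l : List ℕ} (hl : 0 ∉ l) :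
    ∑ u ∈ Finset.Ico c (c + l.sum + 1), φ ((spine c l).count u) = (l.map φ).sum := by
  induction l generalizing c with
  | nil => simp [spine, hφ]
  | cons a l ih =>
    have ha : 0 < a := Nat.pos_of_ne_zero fun h => hl (by simp [h])
    have hl' : 0 ∉ l := fun h => hl (by simp [h])
    rw [List.map_cons, List.sum_cons, List.sum_cons, ← ih (c := c + a) hl',
      ← Finset.sum_Ico_consecutive _ (Nat.le_add_right c 1) (show c + 1 ≤ _ by omega),
      ← Finset.sum_Ico_consecutive _ (show c + 1 ≤ c + a by omega)
        (show c + a ≤ c + (a + l.sum) + 1 by omega)]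
    have hcount : ∀ u, (spine c (a :: l)).count u =
        (if u = c then a else 0) + (spine (c + a) l).count u := by
      intro u
      rw [spine, List.count_append, List.count_replicate]
      by_cases h : u = c
      · subst h; simp
      · simp [h, Ne.symm h]
    have hzero : ∀ u, u < c + a → (spine (c + a) l).count u = 0 := by
      intro u hu
      refine List.count_eq_zero_of_not_mem fun h => ?_
      have := (lt_of_mem_spine hl' h).1
      omega
    have h1 : ∑ u ∈ Finset.Ico c (c + 1), φ ((spine c (a :: l)).count u) = φ a := by
      simp [hcount, hzero c (by omega)]
    have h2 : ∑ u ∈ Finset.Ico (c + 1) (c + a), φ ((spine c (a :: l)).count u) = 0 := by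
      refine Finset.sum_eq_zero fun u hu => ?_
      rw [Finset.mem_Ico] at hu
      rw [hcount, hzero u hu.2, if_neg (by omega), hφ]
    have h3 : ∑ u ∈ Finset.Ico (c + a) (c + (a + l.sum) + 1), φ ((spine c (a :: l)).count u) =
        ∑ u ∈ Finset.Ico (c + a) (c + a + l.sum + 1), φ ((spine (c + a) l).count u) := by
      rw [← add_assoc c a]
      refine Finset.sum_congr rfl fun u hu => ?_
      rw [Finset.mem_Ico] at hu
      rw [hcount, if_neg (by omega), zero_add]
    rw [h1, h2, h3, zero_add]

theorem sum_range_count_mul {r : ℕ} {l : List ℕ} (hl : ∀ x ∈ l, x < r) (g : ℕ → ℕ) :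
    ∑ u ∈ Finset.range r, l.count u * g u = (l.map g).sum := by
  induction l with
  | nil => simp
  | cons a l ih =>
    rw [List.map_cons, List.sum_cons, ← ih fun x hx => hl x (by simp [hx])]
    have ha : a < r := hl a (by simp)
    simp only [List.count_cons, add_mul, Finset.sum_add_distrib]
    rw [add_comm]
    congr 1
    simp [ha]

theorem le_of_mem_levels {k x : ℕ} {l : List ℕ} (h : x ∈ levels k l) : k ≤ x := by
  induction l generalizing k with
  | nil => simp [levels] at h
  | cons a l ih =>
    rcases List.mem_append.1 h with h | h
    · exact (List.eq_of_mem_replicate h).ge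
    · have := ih h; omega

theorem length_levels (k : ℕ) (l : List ℕ) : (levels k l).length = l.sum := by
  induction l generalizing k with
  | nil => simp [levels]
  | cons a l ih => simp [levels, ih]

/-- Double counting: `|x - y|`, written as two truncated differences, is the number of gaps between
two unit weights. The extra weight `L` sits at level `k`, one step left of the first entry. -/
theorem two_mul_gapSum_eq (L k : ℕ) (l : List ℕ) :
    2 * gapSum L 0 l = 2 * L * ((levels (k + 1) l).map (· - k)).sum +
      ((levels (k + 1) l).map fun x =>
        ((levels (k + 1) l).map fun y => (x - y) + (y - x)).sum).sum := by
  induction l generalizing L k with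
  | nil => simp [levels, gapSum]
  | cons a l ih =>
    rw [gapSum, mul_add, ih (L + a) (k + 1), levels]
    generalize hQ : levels (k + 1 + 1) l = Q
    have hge : ∀ x ∈ Q, k + 1 + 1 ≤ x := fun x hx => le_of_mem_levels (hQ ▸ hx)
    have hlen : Q.length = l.sum := by rw [← hQ, length_levels]
    have e1 : (Q.map (· - k)).sum = (Q.map (· - (k + 1))).sum + l.sum := by
      rw [← hlen]
      clear hQ hlen
      induction Q with
      | nil => simp
      | cons x Q ih =>
        have := hge x (by simp)
        have := ih fun x hx => hge x (by simp [hx])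
        simp only [List.map_cons, List.sum_cons, List.length_cons]
        omega
    have e2 : (Q.map fun y => (k + 1 - y) + (y - (k + 1))).sum = (Q.map (· - (k + 1))).sum := by
      congr 1
      refine List.map_congr_left fun y hy => ?_
      have := hge y hy
      omega
    have e3 : (Q.map fun x => a * (x - (k + 1) + (k + 1 - x)) +
          (Q.map fun y => (x - y) + (y - x)).sum).sum =
        a * (Q.map (· - (k + 1))).sum +
          (Q.map fun x => (Q.map fun y => (x - y) + (y - x)).sum).sum := by
      rw [List.sum_map_add, List.sum_map_mul_left]
      congr 3
      refine List.map_congr_left fun y hy => ?_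
      have := hge y hy
      omega
    simp only [List.map_append, List.sum_append, List.map_replicate, List.sum_replicate,
      smul_eq_mul, e2, e3, e1]
    simp only [Nat.sub_self, add_zero, mul_zero, zero_add, Nat.add_sub_cancel_left]
    ring

theorem count_map_range' (p : ℕ → ℕ) (u s n : ℕ) :
    ((List.range' s n).map p).count u = ∑ j ∈ Finset.range n, if p (s + j) = u then 1 else 0 := by
  induction n with
  | zero => simp
  | succ n ih =>
    rw [List.range'_1_concat, List.map_append, List.count_append, ih, Finset.sum_range_succ]
    simp [List.count_singleton]

/-! ### The optimal caterpillar -/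

section Optimal

variable {r : ℕ} {mark : ℕ → ℕ} {l : List ℕ}

-- A vertex other than 0 has its parent edge plus one edge per occurrence in the spine. Vertex 0 has
-- no parent but is the parent of vertex 1, which the spine does not record, so the `+ 1` holds
-- there too.
open Classical in
theorem degree_parentGraph_eq (hr : r = l.sum + 2) (hl : 0 ∉ l)
    (hm : ∀ v, 0 < mark v ↔ v ∈ starts 2 l) (u : Fin r) :
    (parentGraph r (parent mark)).degree u = (spine 1 l).count u.1 + 1 := by
  have hrange : Finset.range r = Finset.range (2 + l.sum) := by rw [hr, add_comm]
  rw [parentGraph_degree (parent_lt mark),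
    Fin.sum_univ_eq_sum_range (fun v => if v ≠ 0 ∧ parent mark v = u then 1 else 0),
    ← (map_parent_range' (c := 1) hl fun v _ _ => hm v).1, count_map_range', hrange,
    Finset.sum_range_add, Finset.sum_range_succ, Finset.sum_range_one]
  have h1 : parent mark 1 = 0 := by simp [parent]
  have h2 : ∀ j, (if 2 + j ≠ 0 ∧ parent mark (2 + j) = u then 1 else 0) =
      if parent mark (1 + 1 + j) = u then 1 else 0 := by
    intro j
    simp
  simp only [h1, h2]
  by_cases h0 : u.1 = 0
  · simp [h0]; ring
  · simp [h0, Ne.symm h0]; ring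

theorem listsNonzero_count_spine (hr : r = l.sum + 2) (hl : 0 ∉ l) :
    ListsNonzero l fun u : Fin r => (spine 1 l).count u.1 := by
  refine ⟨hl, fun φ hφ => ?_⟩
  rw [Fin.sum_univ_eq_sum_range (fun u => φ ((spine 1 l).count u)), Finset.range_eq_Ico,
    ← Finset.sum_Ico_consecutive _ (Nat.zero_le 1) (by omega),
    show r = 1 + l.sum + 1 by omega, sum_count_spine φ hφ hl]
  have : (spine 1 l).count 0 = 0 :=
    List.count_eq_zero_of_not_mem fun h => by
      have := (lt_of_mem_spine hl h).1
      omega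
  simp [this, hφ]

/-- Only a lower bound for the caterpillar is needed, so it is enough that levels never change by
more than 1 along an edge; actual distances on the spine are not computed. -/
theorem two_mul_gapSum_le_weighted (hr : r = l.sum + 2) (hl : 0 ∉ l)
    (hm : ∀ v, 0 < mark v ↔ v ∈ starts 2 l) :
    2 * gapSum 0 0 l ≤ ∑ u : Fin r, ∑ v : Fin r, (spine 1 l).count u.1 * (spine 1 l).count v.1 *
      (parentGraph r (parent mark)).dist u v := by
  have hlev1 : level mark 1 = 0 := by
    have : ¬ 0 < mark 1 := by
      rw [hm]
      intro h
      have := le_of_mem_starts h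
      omega
    simp [level, this]
  have hlev := (map_parent_range' (c := 1) hl fun v _ _ => hm v).2
  rw [hlev1] at hlev
  have hdist : ∀ u v : Fin r, (level mark u - level mark v) + (level mark v - level mark u) ≤
      (parentGraph r (parent mark)).dist u v := by
    intro u v
    have hp := parent_lt mark
    have hc := parentGraph_connected hp (show 0 < r by omega)
    have hstep : ∀ u v : Fin r, (parentGraph r (parent mark)).Adj u v →
        level mark v ≤ level mark u + 1 := by
      intro u v h
      rcases (parentGraph_adj hp).1 h with h | h
      · rw [← h.2]; exact (level_parent mark u).1.trans (Nat.le_succ _)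
      · rw [← h.2]; exact (level_parent mark v).2
    have h1 := le_add_dist hc hstep u v
    have h2 := le_add_dist hc hstep v u
    rw [SimpleGraph.dist_comm] at h2
    omega
  have hlt : ∀ x ∈ spine 1 l, x < r := fun x hx => by
    have := (lt_of_mem_spine hl hx).2
    omega
  calc 2 * gapSum 0 0 l
      = ((spine 1 l).map fun x => ((spine 1 l).map fun y =>
          (level mark x - level mark y) + (level mark y - level mark x)).sum).sum := by
        have h0 : ∀ k, ((levels (k + 1) l).map fun x =>
            ((levels (k + 1) l).map fun y => (x - y) + (y - x)).sum).sum =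
            ((levels k l).map fun x => ((levels k l).map fun y => (x - y) + (y - x)).sum).sum := by
          intro k
          have : ∀ (m : List ℕ) (k : ℕ), levels (k + 1) m = (levels k m).map (· + 1) := by
            intro m
            induction m with
            | nil => simp [levels]
            | cons a m ih => intro k; simp [levels, ih]
          rw [this]
          simp only [List.map_map, Function.comp_def, Nat.add_sub_add_right]
        rw [two_mul_gapSum_eq 0 0, h0, ← hlev]
        simp only [List.map_map, Function.comp_def, mul_zero, zero_mul, zero_add]
    _ = ∑ u : Fin r, (spine 1 l).count u.1 * ∑ v : Fin r, (spine 1 l).count v.1 *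
          ((level mark u - level mark v) + (level mark v - level mark u)) := by
        rw [Fin.sum_univ_eq_sum_range (fun u => (spine 1 l).count u * ∑ v : Fin r,
            (spine 1 l).count v.1 *
              ((level mark u - level mark v) + (level mark v - level mark u))),
          sum_range_count_mul hlt]
        congr 1
        refine List.map_congr_left fun x _ => ?_
        rw [Fin.sum_univ_eq_sum_range (fun v => (spine 1 l).count v *
              ((level mark x - level mark v) + (level mark v - level mark x))),
          sum_range_count_mul hlt]
    _ ≤ _ := by
        refine Finset.sum_le_sum fun u _ => ?_
        rw [Finset.mul_sum]
        refine Finset.sum_le_sum fun v _ => ?_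
        rw [mul_assoc]
        exact Nat.mul_le_mul_left _ (Nat.mul_le_mul_left _ (hdist u v))

open Classical in
/-- The caterpillar whose spine degrees are arranged according to `bestArrangement` has the largest
Wiener index among all trees with the same degree sequence. -/
theorem caterpillar_optimal {d : Fin r → ℕ} (hd : ∀ i, 0 < d i) {b : List ℕ}
    (hr : r = b.sum + 2) (hb : b.Pairwise (· ≥ ·)) (hbd : ListsNonzero b fun i => d i - 1)
    (hm : ∀ v, 0 < mark v ↔ v ∈ starts 2 (bestArrangement 0 0 b)) :
    (parentGraph r (parent mark)).IsTree ∧ HasDegreeSequence (parentGraph r (parent mark)) d ∧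
      ∀ T : SimpleGraph (Fin r), T.IsTree → HasDegreeSequence T d →
        wienerIndex T ≤ wienerIndex (parentGraph r (parent mark)) := by
  have hperm := bestArrangement_perm 0 0 b
  set l := bestArrangement 0 0 b with hl
  have hr' : r = l.sum + 2 := by rw [hperm.sum_eq, hr]
  have hld : ListsNonzero l fun i => d i - 1 := hbd.of_perm hperm
  have hl0 : 0 ∉ l := hld.1
  have htree := parentGraph_isTree (r := r) (parent_lt mark) (by omega)
  have hdeg := degree_parentGraph_eq hr' hl0 hm
  refine ⟨htree, ?_, ?_⟩
  · obtain ⟨e, he⟩ := hld.exists_equiv (listsNonzero_count_spine hr' hl0) rfl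
    refine ⟨e, fun i => ?_⟩
    rw [hdeg, he]
    have := hd i
    omega
  · rintro T hT ⟨e, he⟩
    have hy : ∀ v, T.degree v = (T.degree v - 1) + 1 := by
      intro v
      have h1 := he (e.symm v)
      have h2 := hd (e.symm v)
      rw [Equiv.apply_symm_apply] at h1
      omega
    have h1 := wienerIndex_eq_weighted hT hy
    have h2 := wienerIndex_eq_weighted htree hdeg
    obtain ⟨l', hl', hle⟩ := exists_gapSum_ge_of_isTree hT (fun v => T.degree v - 1) (by
      intro v hv a c hva hvc
      have h1 : T.degree v = 1 := by have := hy v; omega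
      exact (SimpleGraph.degree_eq_one_iff_existsUnique_adj.1 h1).unique hva hvc)
    have hperm' : l'.Perm b := by
      have h3 := hl'.comp_equiv e
      simp only [he] at h3
      exact h3.perm hbd
    have h4 := gapSum_le_bestGapSum hb 0 0 hperm'
    rw [← gapSum_bestArrangement, ← hl] at h4
    have h5 := two_mul_gapSum_le_weighted hr' hl0 hm
    -- Weighted sum of `T` ≤ `2 * gapSum 0 0 l'` ≤ `2 * gapSum 0 0 l` ≤ weighted sum of the
    -- caterpillar; the constant terms in `h1` and `h2` agree.
    omega

end Optimal

/-! ### Reasoning about programs -/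

/-- On a machine with word bound `W`, the program `p` started in state `s` halts within `T` steps in
a state that satisfies `Q`. -/
def Run (W : ℕ) (p : Program) (s : State) (T : ℕ) (Q : State → Prop) : Prop :=
  ∃ t s', Exec W p s t s' ∧ t ≤ T ∧ Q s'

section Run

variable {W T T' T₁ T₂ : ℕ} {p q : Program} {s : State} {Q Q' : State → Prop} {e e₁ e₂ i : Expr}

theorem Run.mono (h : Run W p s T Q) (hT : T ≤ T') : Run W p s T' Q :=
  let ⟨t, s', he, ht, hQ⟩ := h
  ⟨t, s', he, ht.trans hT, hQ⟩

theorem Run.imp (h : Run W p s T Q) (hQ : ∀ s', Q s' → Q' s') : Run W p s T Q' :=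
  let ⟨t, s', he, ht, h'⟩ := h
  ⟨t, s', he, ht, hQ _ h'⟩

theorem Run.skip (h : Q s) : Run W .skip s 1 Q := ⟨_, _, .skip s, le_rfl, h⟩

theorem Run.assign {x : ℕ} (he : e.Fits W s) (h : Q (s.setReg x (e.eval s))) :
    Run W (.assign x e) s (e.cost + 1) Q :=
  ⟨_, _, .assign x e s he, le_rfl, h⟩

theorem Run.store {a : ℕ} (hi : i.Fits W s) (he : e.Fits W s)
    (h : Q (s.setMem a (i.eval s) (e.eval s))) :
    Run W (.store a i e) s (i.cost + e.cost + 1) Q :=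
  ⟨_, _, .store a i e s hi he, le_rfl, h⟩

theorem Run.seq (hp : Run W p s T₁ Q') (hq : ∀ s', Q' s' → Run W q s' T₂ Q) :
    Run W (.seq p q) s (T₁ + T₂) Q := by
  obtain ⟨t, s', he, ht, h'⟩ := hp
  obtain ⟨t₂, s₂, he₂, ht₂, h₂⟩ := hq s' h'
  exact ⟨_, _, .seq he he₂, Nat.add_le_add ht ht₂, h₂⟩

theorem Run.assign_seq {x : ℕ} (he : e.Fits W s) (h : Run W q (s.setReg x (e.eval s)) T Q) :
    Run W (.seq (.assign x e) q) s (e.cost + 1 + T) Q :=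
  (Run.assign (Q := (· = s.setReg x (e.eval s))) he rfl).seq fun _ hs => hs ▸ h

theorem Run.store_seq {a : ℕ} (hi : i.Fits W s) (he : e.Fits W s)
    (h : Run W q (s.setMem a (i.eval s) (e.eval s)) T Q) :
    Run W (.seq (.store a i e) q) s (i.cost + e.cost + 1 + T) Q :=
  (Run.store (Q := (· = s.setMem a (i.eval s) (e.eval s))) hi he rfl).seq fun _ hs => hs ▸ h

theorem Run.ifLt (h₁ : e₁.Fits W s) (h₂ : e₂.Fits W s)
    (hp : e₁.eval s < e₂.eval s → Run W p s T Q) (hq : ¬ e₁.eval s < e₂.eval s → Run W q s T Q) :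
    Run W (.ifLt e₁ e₂ p q) s (e₁.cost + e₂.cost + 1 + T) Q := by
  by_cases h : e₁.eval s < e₂.eval s
  · obtain ⟨t, s', he, ht, h'⟩ := hp h
    exact ⟨_, _, .ifTrue h₁ h₂ h he, Nat.add_le_add_left ht _, h'⟩
  · obtain ⟨t, s', he, ht, h'⟩ := hq h
    exact ⟨_, _, .ifFalse h₁ h₂ h he, Nat.add_le_add_left ht _, h'⟩

/-- A loop with an invariant that is indexed by the number of remaining rounds. -/
theorem Run.whileLt {I : ℕ → State → Prop}
    (hfits : ∀ n s, I n s → e₁.Fits W s ∧ e₂.Fits W s ∧ (e₁.eval s < e₂.eval s ↔ 0 < n))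
    (hstep : ∀ n s, I (n + 1) s → Run W p s T (I n)) (n : ℕ) (h : I n s) :
    Run W (.whileLt e₁ e₂ p) s ((n + 1) * (e₁.cost + e₂.cost + 1 + T)) (I 0) := by
  induction n generalizing s with
  | zero =>
    obtain ⟨h₁, h₂, hlt⟩ := hfits 0 s h
    exact ⟨_, _, .whileFalse h₁ h₂ (by simpa using hlt), by omega, h⟩
  | succ n ih =>
    obtain ⟨h₁, h₂, hlt⟩ := hfits _ s h
    obtain ⟨t, s', he, ht, h'⟩ := hstep n s h
    obtain ⟨t₂, s₂, he₂, ht₂, h₂'⟩ := ih h'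
    refine ⟨_, _, .whileTrue h₁ h₂ (hlt.2 (Nat.succ_pos n)) he he₂, ?_, h₂'⟩
    have : (n + 1 + 1) * (e₁.cost + e₂.cost + 1 + T) =
      (n + 1) * (e₁.cost + e₂.cost + 1 + T) + (e₁.cost + e₂.cost + 1 + T) := by ring
    omega

end Run

section State

variable (s : State) (x y n a b i : ℕ)

theorem State.reg_setReg : (s.setReg x n).reg y = if y = x then n else s.reg y := by
  simp [State.setReg, Function.update_apply]

theorem State.mem_setReg : (s.setReg x n).mem = s.mem := rfl

theorem State.reg_setMem : (s.setMem a i n).reg = s.reg := rfl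

theorem State.mem_setMem :
    (s.setMem a i n).mem b = if b = a then Function.update (s.mem a) i n else s.mem b := by
  simp only [State.setMem, Function.update_apply]

end State

/-- The first cells of the array `f` hold the list `l`. -/
def HoldsList (f : ℕ → ℕ) (l : List ℕ) : Prop :=
  ∀ j (h : j < l.length), f j = l[j]

theorem HoldsList.concat {f : ℕ → ℕ} {l : List ℕ} (h : HoldsList f l) (x : ℕ) :
    HoldsList (Function.update f l.length x) (l ++ [x]) := by
  intro j hj
  rw [List.length_append, List.length_singleton] at hj
  rw [Function.update_apply]
  split_ifs with hjl
  · subst hjl; simp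
  · rw [h j (by omega), List.getElem_append_left]

/-! ### Sorting -/

/-- The list `b` collects, in descending order, the numbers `D j - 1` for those `j < r` for which
`v < D j`, or `D j = v` and `j < i`. -/
structure Collects (D : ℕ → ℕ) (r v i : ℕ) (b : List ℕ) : Prop where
  sorted : b.Pairwise (· ≥ ·)
  le : ∀ x ∈ b, v ≤ x + 1
  sum_eq : ∀ φ : ℕ → ℕ, (b.map φ).sum =
    ∑ j ∈ Finset.range r, if v < D j ∨ (D j = v ∧ j < i) then φ (D j - 1) else 0

section Collects

variable {D : ℕ → ℕ} {r v i : ℕ} {b : List ℕ}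

theorem Collects.nil (h : ∀ j < r, D j < v) : Collects D r v 0 [] := by
  refine ⟨List.Pairwise.nil, by simp, fun φ => ?_⟩
  rw [Finset.sum_eq_zero]
  · simp
  · intro j hj
    have := h j (Finset.mem_range.1 hj)
    exact if_neg (by omega)

theorem Collects.succ_of_ne (h : Collects D r v i b) (hi : D i ≠ v) : Collects D r v (i + 1) b := by
  refine ⟨h.sorted, h.le, fun φ => (h.sum_eq φ).trans (Finset.sum_congr rfl fun j _ => ?_)⟩
  have : (v < D j ∨ (D j = v ∧ j < i)) ↔ (v < D j ∨ (D j = v ∧ j < i + 1)) := by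
    by_cases hj : j = i
    · subst hj; omega
    · omega
  simp only [this]

theorem Collects.succ_of_eq (h : Collects D r v i b) (hv : 0 < v) (hir : i < r) (hi : D i = v) :
    Collects D r v (i + 1) (b ++ [v - 1]) := by
  refine ⟨?_, ?_, fun φ => ?_⟩
  · rw [List.pairwise_append]
    refine ⟨h.sorted, List.pairwise_singleton _ _, fun x hx y hy => ?_⟩
    have h1 := h.le x hx
    have h2 := List.mem_singleton.1 hy
    omega
  · intro x hx
    rcases List.mem_append.1 hx with hx | hx
    · exact h.le x hx
    · have := List.mem_singleton.1 hx
      omega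
  · have hterm : ∀ j, (if v < D j ∨ (D j = v ∧ j < i + 1) then φ (D j - 1) else 0) =
        (if v < D j ∨ (D j = v ∧ j < i) then φ (D j - 1) else 0) +
          if j = i then φ (v - 1) else 0 := by
      intro j
      by_cases hj : j = i
      · subst hj; simp [hi]
      · have : (v < D j ∨ (D j = v ∧ j < i + 1)) ↔ (v < D j ∨ (D j = v ∧ j < i)) := by omega
        simp only [this, if_neg hj, add_zero]
    simp only [hterm, Finset.sum_add_distrib, ← h.sum_eq]
    simp [hir]

theorem Collects.next (h : Collects D r v r b) (hv : 0 < v) : Collects D r (v - 1) 0 b := by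
  refine ⟨h.sorted, fun x hx => ?_, fun φ => (h.sum_eq φ).trans (Finset.sum_congr rfl fun j hj => ?_)⟩
  · have := h.le x hx; omega
  · have hj' := Finset.mem_range.1 hj
    have : (v < D j ∨ (D j = v ∧ j < r)) ↔ (v - 1 < D j ∨ (D j = v - 1 ∧ j < 0)) := by omega
    simp only [this]

/-- Stopping at value 1 with no index scanned leaves out exactly the leaves, whose reduced degree is
0. -/
theorem Collects.listsNonzero {d : Fin r → ℕ} (h : Collects D r 1 0 b)
    (hd : ∀ i, 0 < d i) (hD : ∀ i : Fin r, D i = d i) : ListsNonzero b fun i => d i - 1 := by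
  constructor
  · intro h0
    have h1 := h.sum_eq fun n => if n = 0 then 1 else 0
    rw [sum_map_ite_eq, Finset.sum_eq_zero] at h1
    · exact List.count_eq_zero.1 h1 h0
    · intro j _
      split_ifs <;> omega
  · intro φ hφ
    rw [h.sum_eq, ← Fin.sum_univ_eq_sum_range
      (fun j => if 1 < D j ∨ (D j = 1 ∧ j < 0) then φ (D j - 1) else 0)]
    refine Finset.sum_congr rfl fun i _ => ?_
    rw [hD]
    split_ifs with h'
    · rfl
    · have := hd i
      change 0 = φ (d i - 1)
      rw [show d i - 1 = 0 by omega, hφ]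

end Collects

/-- Compares cell `i` of the input with the current value `v` and collects it on equality. -/
def collectStep : Program :=
  .seq
    (.ifLt (.read 0 (.reg 3)) (.reg 2) .skip
      (.ifLt (.reg 2) (.read 0 (.reg 3)) .skip
        (.seq (.store 3 (.reg 1) (.sub (.reg 2) (.lit 1)))
          (.assign 1 (.add (.reg 1) (.lit 1))))))
    (.assign 3 (.add (.reg 3) (.lit 1)))

/-- Collects all cells of the input that hold the current value `v`. -/
def collectRound : Program :=
  .seq (.assign 3 (.lit 0))
    (.seq (.whileLt (.reg 3) (.reg 0) collectStep) (.assign 2 (.sub (.reg 2) (.lit 1))))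

/-- Writes the reduced degrees that are not zero to array `3`, in descending order, and their number
to register `1`. -/
def sortProgram : Program :=
  .seq (.assign 2 (.reg 0)) (.whileLt (.lit 1) (.reg 2) collectRound)

/-- The invariant of the sorting phase. -/
structure SortInv (D : ℕ → ℕ) (r v i : ℕ) (b : List ℕ) (s : State) : Prop where
  reg0 : s.reg 0 = r
  reg1 : s.reg 1 = b.length
  reg2 : s.reg 2 = v
  mem0 : s.mem 0 = D
  mem3 : HoldsList (s.mem 3) b
  mem5 : s.mem 5 = fun _ => 0
  collects : Collects D r v i b

section Sorting

variable {W : ℕ} {D : ℕ → ℕ} {r v i : ℕ} {b : List ℕ} {s : State}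

theorem Collects.length_le (h : Collects D r v i b) : b.length ≤ r := by
  have := h.sum_eq fun _ => 1
  rw [List.map_const', List.sum_replicate, smul_eq_mul, mul_one] at this
  rw [this]
  refine (Finset.sum_le_sum (g := fun _ => 1) fun j _ => ?_).trans (by simp)
  split_ifs <;> simp

theorem run_collectStep (hW : r + 1 ≤ W) (hD : ∀ j < r, D j ≤ r) (hv : 0 < v) (hvr : v ≤ r)
    (hi : s.reg 3 = i) (hir : i < r) (h : SortInv D r v i b s) :
    Run W collectStep s 30 fun s' => s'.reg 3 = i + 1 ∧ ∃ b', SortInv D r v (i + 1) b' s' := by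
  have hlen := h.collects.length_le
  have hDi := hD i hir
  refine Run.mono (Run.seq (T₂ := 4) (T₁ := 20)
    (Q' := fun s' => s'.reg 3 = i ∧ ∃ b', SortInv D r v (i + 1) b' s') ?_ ?_) (by norm_num)
  · refine Run.mono (Run.ifLt (T := 16) ?_ ?_ ?_ ?_) (by simp [Expr.cost])
    · simp only [Expr.Fits, Expr.eval, hi, h.mem0]; omega
    · simp only [Expr.Fits, h.reg2]; omega
    · intro hlt
      simp only [Expr.eval, hi, h.mem0, h.reg2] at hlt
      exact Run.mono (Run.skip ⟨hi, b, { h with collects := h.collects.succ_of_ne hlt.ne }⟩)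
        (by norm_num)
    · intro hlt
      refine Run.mono (Run.ifLt (T := 11) ?_ ?_ ?_ ?_) (by simp [Expr.cost])
      · simp only [Expr.Fits, h.reg2]; omega
      · simp only [Expr.Fits, Expr.eval, hi, h.mem0]; omega
      · intro hlt
        simp only [Expr.eval, hi, h.mem0, h.reg2] at hlt
        exact Run.mono (Run.skip ⟨hi, b, { h with collects := h.collects.succ_of_ne hlt.ne' }⟩)
          (by norm_num)
      · intro hlt'
        simp only [Expr.eval, hi, h.mem0, h.reg2] at hlt hlt'
        refine Run.mono (Run.store_seq ?_ ?_ (Run.assign ?_ ⟨?_, b ++ [v - 1], ?_⟩))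
          (by simp [Expr.cost])
        · simp only [Expr.Fits, h.reg1]; omega
        · simp only [Expr.Fits, h.reg2]; omega
        · simp only [Expr.Fits, Expr.eval, State.reg_setMem, h.reg1]; omega
        · simpa [State.reg_setReg, State.reg_setMem] using hi
        · have hc := h.collects.succ_of_eq hv hir (by omega)
          have h3 := h.mem3.concat (v - 1)
          constructor <;>
            simp [State.reg_setReg, State.reg_setMem, State.mem_setReg, State.mem_setMem,
              Expr.eval, h.reg0, h.reg1, h.reg2, h.mem0, h.mem5, h3, hc]
  · rintro s' ⟨hi', b', h'⟩
    refine Run.mono (Run.assign ?_ ⟨?_, b', ?_⟩) (by simp [Expr.cost])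
    · simp only [Expr.Fits, Expr.eval, hi']; omega
    · simp [State.reg_setReg, Expr.eval, hi']
    · constructor <;> simp [State.reg_setReg, State.mem_setReg, h'.reg0, h'.reg1, h'.reg2,
        h'.mem0, h'.mem5, h'.mem3, h'.collects]

theorem run_collectRound (hW : r + 1 ≤ W) (hD : ∀ j < r, D j ≤ r) (hv : 0 < v) (hvr : v ≤ r)
    (h : SortInv D r v 0 b s) :
    Run W collectRound s (33 * (r + 1) + 6) fun s' => ∃ b', SortInv D r (v - 1) 0 b' s' := by
  refine Run.mono (Run.assign_seq (T := 33 * (r + 1) + 4) (by simp [Expr.Fits])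
    (Run.seq (T₁ := 33 * (r + 1)) (T₂ := 4) (Q' := fun s' => ∃ b', SortInv D r v r b' s') ?_ ?_))
    (by simp [Expr.cost]; omega)
  · refine Run.mono (Run.imp (Run.whileLt (T := 30) (I := fun n s' => n ≤ r ∧ s'.reg 3 = r - n ∧
      ∃ b', SortInv D r v (r - n) b' s') ?_ ?_ r ?_) ?_) (by simp [Expr.cost]; omega)
    · rintro n s' ⟨hn, hi, b', h'⟩
      simp only [Expr.Fits, Expr.eval, hi, h'.reg0]; omega
    · rintro n s' ⟨hn, hi, b', h'⟩
      refine (run_collectStep hW hD hv hvr hi (by omega) h').imp ?_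
      rintro s'' ⟨hi', b'', h''⟩
      have : r - (n + 1) + 1 = r - n := by omega
      rw [this] at hi' h''
      exact ⟨by omega, hi', b'', h''⟩
    · refine ⟨le_rfl, by simp [State.reg_setReg, Expr.eval], b, ?_⟩
      rw [Nat.sub_self]
      constructor <;> simp [State.reg_setReg, State.mem_setReg, h.reg0, h.reg1, h.reg2,
        h.mem0, h.mem5, h.mem3, h.collects]
    · rintro s' ⟨-, -, b', h'⟩
      exact ⟨b', h'⟩
  · rintro s' ⟨b', h'⟩
    refine Run.mono (Run.assign ?_ ⟨b', ?_⟩) (by simp [Expr.cost])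
    · simp only [Expr.Fits, h'.reg2]; omega
    · constructor <;> simp [State.reg_setReg, State.mem_setReg, Expr.eval, h'.reg0, h'.reg1,
        h'.reg2, h'.mem0, h'.mem5, h'.mem3, h'.collects.next hv]

/-- The value runs from `r`, above all degrees, down to 1, with one scan of the input per value. The
blankness of array 5 is carried along because the placing phase uses that array for its marks. -/
theorem run_sortProgram (hr : 0 < r) (hW : r + 1 ≤ W) (hD : ∀ j < r, D j < r)
    (h0 : s.reg 0 = r) (h1 : s.reg 1 = 0) (hm0 : s.mem 0 = D) (hm5 : s.mem 5 = fun _ => 0) :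
    Run W sortProgram s (r * (33 * (r + 1) + 9) + 2) fun s' => ∃ b, SortInv D r 1 0 b s' := by
  refine Run.mono (Run.assign_seq (T := r * (33 * (r + 1) + 9)) (by simp [Expr.Fits, h0]; omega) ?_)
    (by simp [Expr.cost]; omega)
  refine Run.mono (Run.imp (Run.whileLt (T := 33 * (r + 1) + 6) (I := fun n s' => n < r ∧
      ∃ b', SortInv D r (n + 1) 0 b' s') ?_ ?_ (r - 1) ?_) ?_) ?_
  · rintro n s' ⟨hn, b', h'⟩
    simp only [Expr.Fits, Expr.eval, h'.reg2]; omega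
  · rintro n s' ⟨hn, b', h'⟩
    refine (run_collectRound hW (fun j hj => (hD j hj).le) (by omega) (by omega) h').imp ?_
    rintro s'' ⟨b'', h''⟩
    exact ⟨by omega, b'', h''⟩
  · refine ⟨by omega, [], ?_⟩
    rw [Nat.sub_add_cancel hr]
    have hc := Collects.nil hD
    constructor <;> simp [State.reg_setReg, State.mem_setReg, Expr.eval, h0, h1, hm0, hm5, hc,
      HoldsList]
  · rintro s' ⟨-, b', h'⟩
    exact ⟨b', h'⟩
  · rw [Nat.sub_add_cancel hr]
    exact Nat.mul_le_mul_left _ (by simp [Expr.cost]; omega)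

end Sorting

/-! ### Dynamic programming -/

/-- The sum of the first `t` entries. -/
def prefixSum (b : List ℕ) (t : ℕ) : ℕ := (b.take t).sum

section PrefixSum

variable {b : List ℕ} {t : ℕ}

theorem prefixSum_succ (ht : t < b.length) : prefixSum b (t + 1) = prefixSum b t + b[t] := by
  rw [prefixSum, prefixSum, List.take_succ_eq_append_getElem ht, List.sum_append]
  simp

theorem prefixSum_add (b : List ℕ) (t : ℕ) : prefixSum b t + (b.drop t).sum = b.sum := by
  rw [prefixSum, ← List.sum_append, List.take_append_drop]

theorem prefixSum_length (b : List ℕ) : prefixSum b b.length = b.sum := by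
  rw [prefixSum, List.take_length]

end PrefixSum

/-- The table `V` with rows of length `r` holds the right values in all rows below row `t` and in
the first `L` cells of row `t`: the cell for `t'` and `L'` holds the best possible sum for the
weights from the `t'`-th on, when the weights before sum up to `L'` on the left. -/
def Filled (V : ℕ → ℕ) (r : ℕ) (b : List ℕ) (t L : ℕ) : Prop :=
  ∀ t' L', t' ≤ b.length → L' ≤ prefixSum b t' → (t < t' ∨ (t' = t ∧ L' < L)) →
    V (t' * r + L') = bestGapSum L' (prefixSum b t' - L') (b.drop t')

section Filled

variable {V : ℕ → ℕ} {r : ℕ} {b : List ℕ} {t L : ℕ}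

theorem Filled.start : Filled V r b b.length 0 := by
  intro t' L' h1 _ h3
  omega

theorem Filled.next (h : Filled V r b (t + 1) (prefixSum b (t + 1) + 1)) : Filled V r b t 0 := by
  intro t' L' h1 h2 h3
  refine h t' L' h1 h2 ?_
  rcases Nat.lt_or_ge (t + 1) t' with h4 | h4
  · exact Or.inl h4
  · have : t' = t + 1 := by omega
    subst this
    exact Or.inr ⟨rfl, by omega⟩

theorem Filled.store (h : Filled V r b t L) (hr : b.sum < r) (hL : L ≤ prefixSum b t) :
    Filled (Function.update V (t * r + L) (bestGapSum L (prefixSum b t - L) (b.drop t)))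
      r b t (L + 1) := by
  intro t' L' h1 h2 h3
  by_cases heq : t' = t ∧ L' = L
  · obtain ⟨rfl, rfl⟩ := heq
    rw [Function.update_self]
  · rw [Function.update_of_ne]
    · exact h t' L' h1 h2 (by omega)
    · intro hidx
      have hb := prefixSum_add b t
      have hb' := prefixSum_add b t'
      -- Addresses of different cells differ: both offsets are at most `b.sum < r`, so rows do not
      -- overlap.
      rcases lt_trichotomy t t' with hlt | hlt | hlt
      · have := Nat.mul_le_mul_right r (Nat.succ_le_of_lt hlt)
        rw [Nat.succ_mul] at this
        omega
      · subst hlt; omega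
      · have := Nat.mul_le_mul_right r (Nat.succ_le_of_lt hlt)
        rw [Nat.succ_mul] at this
        omega

end Filled

/-- The cell of the table for `t` and `L`, where `L` is in register `6`. -/
def cellExpr : Expr := .add (.mul (.reg 4) (.reg 0)) (.reg 6)

/-- The best sum when the next weight is placed at the left end. -/
def leftExpr : Expr :=
  .add (.mul (.reg 6) (.sub (.reg 7) (.reg 6)))
    (.read 4 (.add (.mul (.add (.reg 4) (.lit 1)) (.reg 0)) (.add (.reg 6) (.reg 8))))

/-- The best sum when the next weight is placed at the right end. -/
def rightExpr : Expr :=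
  .add (.mul (.sub (.reg 5) (.reg 6)) (.sub (.reg 7) (.sub (.reg 5) (.reg 6))))
    (.read 4 (.add (.mul (.add (.reg 4) (.lit 1)) (.reg 0)) (.reg 6)))

/-- Fills one cell of the last row of the table. -/
def lastRowStep : Program :=
  .seq (.store 4 cellExpr (.mul (.reg 6) (.sub (.reg 7) (.reg 6))))
    (.assign 6 (.add (.reg 6) (.lit 1)))

/-- Fills the last row of the table. -/
def lastRowProgram : Program :=
  .seq (.assign 7 (.sub (.reg 0) (.lit 2))) <|
  .seq (.assign 5 (.reg 7)) <|
  .seq (.assign 4 (.reg 1)) <|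
  .seq (.assign 6 (.lit 0)) <|
  .whileLt (.reg 6) (.add (.reg 5) (.lit 1)) lastRowStep

/-- Fills one cell of a row of the table from the next row. -/
def rowStep : Program :=
  .seq (.ifLt leftExpr rightExpr (.store 4 cellExpr rightExpr) (.store 4 cellExpr leftExpr))
    (.assign 6 (.add (.reg 6) (.lit 1)))

/-- Fills one row of the table from the next row. -/
def rowProgram : Program :=
  .seq (.assign 4 (.sub (.reg 4) (.lit 1))) <|
  .seq (.assign 8 (.read 3 (.reg 4))) <|
  .seq (.assign 5 (.sub (.reg 5) (.reg 8))) <|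
  .seq (.assign 6 (.lit 0)) <|
  .whileLt (.reg 6) (.add (.reg 5) (.lit 1)) rowStep

/-- Fills the table. -/
def tableProgram : Program :=
  .seq lastRowProgram (.whileLt (.lit 0) (.reg 4) rowProgram)

/-- The registers and the list of weights while row `t` of the table is in use. -/
structure RowInv (r : ℕ) (b : List ℕ) (t : ℕ) (s : State) : Prop where
  reg0 : s.reg 0 = r
  reg1 : s.reg 1 = b.length
  reg4 : s.reg 4 = t
  reg5 : s.reg 5 = prefixSum b t
  reg7 : s.reg 7 = b.sum
  mem3 : HoldsList (s.mem 3) b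

section Table

variable {W r t L : ℕ} {b : List ℕ} {s : State}

theorem bestGapSum_row_le (hr : b.sum < r) (hb : b.length ≤ r) (hL : L ≤ prefixSum b t) :
    bestGapSum L (prefixSum b t - L) (b.drop t) ≤ r ^ 3 + r ^ 2 := by
  have h1 := bestGapSum_le L (prefixSum b t - L) (b.drop t)
  have h2 := prefixSum_add b t
  have h3 : L + (b.drop t).sum + (prefixSum b t - L) ≤ r := by omega
  have h4 : (b.drop t).length + 1 ≤ r + 1 := by rw [List.length_drop]; omega
  calc _ ≤ _ := h1
    _ ≤ (r + 1) * r ^ 2 := Nat.mul_le_mul h4 (Nat.pow_le_pow_left h3 2)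
    _ = r ^ 3 + r ^ 2 := by ring

/-- For `omega` the powers of `r` are atoms; these facts let it settle the word bounds of the table
and placing phases. -/
theorem word_bounds (hr : 2 ≤ r) (hW : 8 * r ^ 3 ≤ W) :
    r ^ 2 ≤ r ^ 3 ∧ r * r = r ^ 2 ∧ 2 * r ≤ r ^ 2 ∧ 8 * r ^ 3 ≤ W := by
  refine ⟨Nat.pow_le_pow_right (by omega) (by norm_num), (sq r).symm, ?_, hW⟩
  rw [sq]
  exact Nat.mul_le_mul_right r hr

theorem mul_le_sq {x y : ℕ} (hx : x ≤ r) (hy : y ≤ r) : x * y ≤ r ^ 2 := by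
  rw [sq]
  exact Nat.mul_le_mul hx hy

theorem leftExpr_spec (hr : b.sum + 2 = r) (hb : b.length ≤ r) (hW : 8 * r ^ 3 ≤ W)
    (h : RowInv r b t s) (ht : t < b.length) (h6 : s.reg 6 = L) (hL : L ≤ prefixSum b t)
    (h8 : s.reg 8 = b[t]) (hV : Filled (s.mem 4) r b t 0) :
    leftExpr.Fits W s ∧ leftExpr.eval s = L * (b[t] + (b.drop (t + 1)).sum + (prefixSum b t - L)) +
      bestGapSum (L + b[t]) (prefixSum b t - L) (b.drop (t + 1)) := by
  obtain ⟨w1, w2, w3, w4⟩ := word_bounds (by omega) hW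
  have hs := prefixSum_succ ht
  have hsum := prefixSum_add b (t + 1)
  have hcell := hV (t + 1) (L + b[t]) ht (by omega) (Or.inl (Nat.lt_succ_self t))
  have hle := bestGapSum_row_le (t := t + 1) (L := L + b[t]) (r := r) (by omega) hb (by omega)
  rw [show prefixSum b (t + 1) - (L + b[t]) = prefixSum b t - L by omega] at hcell hle
  -- All weight not on the left is the total minus `L`, which is how the program computes this
  -- factor without suffix sums.
  rw [show b[t] + (b.drop (t + 1)).sum + (prefixSum b t - L) = b.sum - L by omega]
  have hm1 : L * (b.sum - L) ≤ r ^ 2 := mul_le_sq (by omega) (by omega)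
  have hm2 : (t + 1) * r ≤ r ^ 2 := mul_le_sq (by omega) le_rfl
  refine ⟨?_, ?_⟩
  · simp only [leftExpr, Expr.Fits, Expr.eval, h.reg0, h.reg4, h.reg7, h6, h8, hcell]
    omega
  · simp only [leftExpr, Expr.eval, h.reg0, h.reg4, h.reg7, h6, h8, hcell]

theorem rightExpr_spec (hr : b.sum + 2 = r) (hb : b.length ≤ r) (hW : 8 * r ^ 3 ≤ W)
    (h : RowInv r b t s) (ht : t < b.length) (h6 : s.reg 6 = L) (hL : L ≤ prefixSum b t)
    (hV : Filled (s.mem 4) r b t 0) :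
    rightExpr.Fits W s ∧ rightExpr.eval s = (prefixSum b t - L) * (b[t] + (b.drop (t + 1)).sum + L) +
      bestGapSum L (prefixSum b t - L + b[t]) (b.drop (t + 1)) := by
  obtain ⟨w1, w2, w3, w4⟩ := word_bounds (by omega) hW
  have hs := prefixSum_succ ht
  have hsum := prefixSum_add b (t + 1)
  have hcell := hV (t + 1) L ht (by omega) (Or.inl (Nat.lt_succ_self t))
  have hle := bestGapSum_row_le (t := t + 1) (L := L) (r := r) (by omega) hb (by omega)
  rw [show prefixSum b (t + 1) - L = prefixSum b t - L + b[t] by omega] at hcell hle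
  rw [show b[t] + (b.drop (t + 1)).sum + L = b.sum - (prefixSum b t - L) by omega]
  have hm1 : (prefixSum b t - L) * (b.sum - (prefixSum b t - L)) ≤ r ^ 2 :=
    mul_le_sq (by omega) (by omega)
  have hm2 : (t + 1) * r ≤ r ^ 2 := mul_le_sq (by omega) le_rfl
  refine ⟨?_, ?_⟩
  · simp only [rightExpr, Expr.Fits, Expr.eval, h.reg0, h.reg4, h.reg5, h.reg7, h6, hcell]
    omega
  · simp only [rightExpr, Expr.eval, h.reg0, h.reg4, h.reg5, h.reg7, h6, hcell]

theorem cellExpr_spec (hr : b.sum + 2 = r) (hb : b.length ≤ r) (hW : 8 * r ^ 3 ≤ W)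
    (h : RowInv r b t s) (ht : t ≤ b.length) (h6 : s.reg 6 = L) (hL : L ≤ prefixSum b t) :
    cellExpr.Fits W s ∧ cellExpr.eval s = t * r + L := by
  obtain ⟨w1, w2, w3, w4⟩ := word_bounds (by omega) hW
  have hsum := prefixSum_add b t
  have hm : t * r ≤ r ^ 2 := mul_le_sq (by omega) le_rfl
  refine ⟨?_, ?_⟩
  · simp only [cellExpr, Expr.Fits, Expr.eval, h.reg0, h.reg4, h6]
    omega
  · simp only [cellExpr, Expr.eval, h.reg0, h.reg4, h6]

theorem RowInv.store_cell (h : RowInv r b t s) (i n : ℕ) : RowInv r b t (s.setMem 4 i n) := by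
  constructor <;> simp [State.reg_setMem, State.mem_setMem, h.reg0, h.reg1, h.reg4, h.reg5, h.reg7,
    h.mem3]

theorem RowInv.setReg (h : RowInv r b t s) {x n : ℕ} (hx : x = 6 ∨ x = 8) :
    RowInv r b t (s.setReg x n) := by
  rcases hx with rfl | rfl <;> constructor <;>
    simp [State.reg_setReg, State.mem_setReg, h.reg0, h.reg1, h.reg4, h.reg5, h.reg7, h.mem3]

theorem run_lastRowProgram (hr : b.sum + 2 = r) (hb : b.length ≤ r) (hW : 8 * r ^ 3 ≤ W)
    (h0 : s.reg 0 = r) (h1 : s.reg 1 = b.length) (hm3 : HoldsList (s.mem 3) b)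
    (hm5 : s.mem 5 = fun _ => 0) :
    Run W lastRowProgram s (20 * r + 20) fun s' =>
      RowInv r b b.length s' ∧ s'.mem 5 = (fun _ => 0) ∧
        Filled (s'.mem 4) r b b.length (prefixSum b b.length + 1) := by
  obtain ⟨w1, w2, w3, w4⟩ := word_bounds (by omega) hW
  have hN := prefixSum_length b
  refine Run.mono (Run.assign_seq ?_ <| Run.assign_seq ?_ <| Run.assign_seq ?_ <|
    Run.assign_seq ?_ <| Run.imp (Run.whileLt (T := 15) (I := fun n s' => n ≤ b.sum + 1 ∧
      s'.reg 6 = b.sum + 1 - n ∧ RowInv r b b.length s' ∧ s'.mem 5 = (fun _ => 0) ∧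
        Filled (s'.mem 4) r b b.length (b.sum + 1 - n)) ?_ ?_ (b.sum + 1) ?_) ?_) ?_
  · simp only [Expr.Fits, h0]; omega
  · simp only [Expr.Fits, Expr.eval, State.reg_setReg, h0]; simp; omega
  · simp only [Expr.Fits, State.reg_setReg, h1]; simp; omega
  · simp [Expr.Fits]
  · rintro n s' ⟨hn, h6, h, -, -⟩
    simp only [Expr.Fits, Expr.eval, h6, h.reg5, hN]; omega
  · rintro n s' ⟨hn, h6, h, h5, hF⟩
    have hL : b.sum + 1 - (n + 1) ≤ prefixSum b b.length := by omega
    obtain ⟨hc, hce⟩ := cellExpr_spec hr hb hW h le_rfl h6 hL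
    have hm : (b.sum + 1 - (n + 1)) * (b.sum - (b.sum + 1 - (n + 1))) ≤ r ^ 2 :=
      mul_le_sq (by omega) (by omega)
    refine Run.mono (Run.store_seq hc ?_ (Run.assign ?_ ⟨by omega, ?_, ?_, ?_, ?_⟩)) ?_
    · simp only [Expr.Fits, Expr.eval, h6, h.reg7]; omega
    · simp only [Expr.Fits, Expr.eval, State.reg_setMem, h6]; omega
    · simp only [State.reg_setReg, State.reg_setMem, Expr.eval, h6, if_true]; omega
    · exact (h.store_cell _ _).setReg (Or.inl rfl)
    · simp [State.mem_setReg, State.mem_setMem, h5]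
    · have hF' := hF.store (by omega) hL
      rw [List.drop_length, bestGapSum, hN, show b.sum + 1 - (n + 1) + 1 = b.sum + 1 - n by omega]
        at hF'
      simpa [State.mem_setReg, State.mem_setMem, hce, Expr.eval, h6, h.reg7] using hF'
    · simp [Expr.cost, cellExpr]
  · refine ⟨le_rfl, ?_, ?_, ?_, ?_⟩
    · simp [State.reg_setReg, Expr.eval]
    · constructor <;> simp [State.reg_setReg, State.mem_setReg, Expr.eval, h0, h1, hm3, hN] <;>
        omega
    · simp [State.mem_setReg, hm5]
    · rw [Nat.sub_self]; exact Filled.start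
  · rintro s' ⟨-, -, h, h5, hF⟩
    rw [hN]
    exact ⟨h, h5, hF⟩
  · simp only [Expr.cost]; omega

theorem run_rowStep (hr : b.sum + 2 = r) (hb : b.length ≤ r) (hW : 8 * r ^ 3 ≤ W)
    (h : RowInv r b t s) (ht : t < b.length) (h6 : s.reg 6 = L) (hL : L ≤ prefixSum b t)
    (h8 : s.reg 8 = b[t]) (hm5 : s.mem 5 = fun _ => 0) (hV : Filled (s.mem 4) r b t L) :
    Run W rowStep s 80 fun s' => RowInv r b t s' ∧ s'.reg 6 = L + 1 ∧ s'.reg 8 = b[t] ∧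
      s'.mem 5 = (fun _ => 0) ∧ Filled (s'.mem 4) r b t (L + 1) := by
  obtain ⟨w1, w2, w3, w4⟩ := word_bounds (by omega) hW
  have hsum := prefixSum_add b t
  -- The cells already written in row `t` are irrelevant here: both options read only row `t + 1`.
  have hV0 : Filled (s.mem 4) r b t 0 := fun t' L' h1 h2 h3 => hV t' L' h1 h2 (by omega)
  obtain ⟨hc, hce⟩ := cellExpr_spec hr hb hW h ht.le h6 hL
  obtain ⟨hlf, hle⟩ := leftExpr_spec hr hb hW h ht h6 hL h8 hV0
  obtain ⟨hrf, hre⟩ := rightExpr_spec hr hb hW h ht h6 hL hV0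
  have hbest : bestGapSum L (prefixSum b t - L) (b.drop t) =
      max (leftExpr.eval s) (rightExpr.eval s) := by
    rw [List.drop_eq_getElem_cons ht, bestGapSum, hle, hre]
  have hF := hV.store (by omega) hL
  rw [hbest] at hF
  have hfin : ∀ n, n = max (leftExpr.eval s) (rightExpr.eval s) →
      Run W (.assign 6 (.add (.reg 6) (.lit 1))) (s.setMem 4 (cellExpr.eval s) n) 4 fun s' =>
        RowInv r b t s' ∧ s'.reg 6 = L + 1 ∧ s'.reg 8 = b[t] ∧
          s'.mem 5 = (fun _ => 0) ∧ Filled (s'.mem 4) r b t (L + 1) := by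
    intro n hn
    refine Run.mono (Run.assign ?_ ⟨?_, ?_, ?_, ?_, ?_⟩) (by simp [Expr.cost])
    · simp only [Expr.Fits, Expr.eval, State.reg_setMem, h6]; omega
    · exact (h.store_cell _ _).setReg (Or.inl rfl)
    · simp [State.reg_setReg, State.reg_setMem, Expr.eval, h6]
    · simp [State.reg_setReg, State.reg_setMem, h8]
    · simp [State.mem_setReg, State.mem_setMem, hm5]
    · simpa [State.mem_setReg, State.mem_setMem, hce, hn] using hF
  refine Run.mono (Run.seq (T₁ := 70) (T₂ := 4)
    (Q' := fun s' => s' = s.setMem 4 (cellExpr.eval s)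
      (max (leftExpr.eval s) (rightExpr.eval s))) ?_ ?_) (by norm_num)
  · refine Run.mono (Run.ifLt (T := 25) hlf hrf ?_ ?_) (by simp [Expr.cost, leftExpr, rightExpr])
    · intro hlt
      refine Run.mono (Run.store hc hrf ?_) (by simp [Expr.cost, cellExpr, rightExpr])
      rw [max_eq_right hlt.le]
    · intro hlt
      refine Run.mono (Run.store hc hlf ?_) (by simp [Expr.cost, cellExpr, leftExpr])
      rw [max_eq_left (not_lt.1 hlt)]
  · rintro s' rfl
    exact hfin _ rfl

theorem run_rowProgram (hr : b.sum + 2 = r) (hb : b.length ≤ r) (hW : 8 * r ^ 3 ≤ W)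
    (h : RowInv r b (t + 1) s) (ht : t < b.length) (hm5 : s.mem 5 = fun _ => 0)
    (hV : Filled (s.mem 4) r b (t + 1) (prefixSum b (t + 1) + 1)) :
    Run W rowProgram s (90 * r + 20) fun s' => RowInv r b t s' ∧ s'.mem 5 = (fun _ => 0) ∧
      Filled (s'.mem 4) r b t (prefixSum b t + 1) := by
  obtain ⟨w1, w2, w3, w4⟩ := word_bounds (by omega) hW
  have hsum := prefixSum_add b t
  have hs := prefixSum_succ ht
  have hsum' := prefixSum_add b (t + 1)
  have hbt : s.mem 3 t = b[t] := h.mem3 t ht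
  refine Run.mono (Run.assign_seq ?_ <| Run.assign_seq ?_ <| Run.assign_seq ?_ <|
    Run.assign_seq ?_ <| Run.imp (Run.whileLt (T := 80) (I := fun n s' => n ≤ prefixSum b t + 1 ∧
      RowInv r b t s' ∧ s'.reg 6 = prefixSum b t + 1 - n ∧ s'.reg 8 = b[t] ∧
      s'.mem 5 = (fun _ => 0) ∧ Filled (s'.mem 4) r b t (prefixSum b t + 1 - n))
      ?_ ?_ (prefixSum b t + 1) ?_) ?_) ?_
  · simp only [Expr.Fits, h.reg4]; omega
  · simp only [Expr.Fits, Expr.eval, State.reg_setReg, State.mem_setReg, h.reg4]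
    simp [hbt]; omega
  · simp only [Expr.Fits, Expr.eval, State.reg_setReg, State.mem_setReg, h.reg4, h.reg5]
    simp [hbt]; omega
  · simp [Expr.Fits]
  · rintro n s' ⟨hn, h', h6, -⟩
    simp only [Expr.Fits, Expr.eval, h6, h'.reg5]; omega
  · rintro n s' ⟨hn, h', h6, h8, h5, hF⟩
    refine (run_rowStep hr hb hW h' ht h6 (by omega) h8 h5 hF).imp ?_
    rintro s'' ⟨g1, g2, g3, g4, g5⟩
    rw [show prefixSum b t + 1 - (n + 1) + 1 = prefixSum b t + 1 - n by omega] at g2 g5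
    exact ⟨by omega, g1, g2, g3, g4, g5⟩
  · refine ⟨le_rfl, ?_, ?_, ?_, ?_, ?_⟩
    · have hmem := h.mem3
      constructor <;> simp [State.reg_setReg, State.mem_setReg, Expr.eval, h.reg0, h.reg1, h.reg4,
        h.reg5, h.reg7, hbt, hs, hmem]
    · simp [State.reg_setReg, Expr.eval]
    · simp [State.reg_setReg, State.mem_setReg, Expr.eval, h.reg4, hbt]
    · simp [State.mem_setReg, hm5]
    · rw [Nat.sub_self]; exact hV.next
  · rintro s' ⟨-, h', -, -, h5, hF⟩
    exact ⟨h', h5, hF⟩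
  · simp only [Expr.cost]; omega

theorem run_tableProgram (hr : b.sum + 2 = r) (hb : b.length ≤ r) (hW : 8 * r ^ 3 ≤ W)
    (h0 : s.reg 0 = r) (h1 : s.reg 1 = b.length) (hm3 : HoldsList (s.mem 3) b)
    (hm5 : s.mem 5 = fun _ => 0) :
    Run W tableProgram s (20 * r + 20 + (r + 1) * (90 * r + 23)) fun s' =>
      RowInv r b 0 s' ∧ s'.mem 5 = (fun _ => 0) ∧ Filled (s'.mem 4) r b 0 (prefixSum b 0 + 1) := by
  obtain ⟨w1, w2, w3, w4⟩ := word_bounds (by omega) hW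
  refine Run.seq (run_lastRowProgram hr hb hW h0 h1 hm3 hm5) ?_
  rintro s' ⟨h, h5, hF⟩
  refine Run.mono (Run.imp (Run.whileLt (T := 90 * r + 20) (I := fun n s' => n ≤ b.length ∧
    RowInv r b n s' ∧ s'.mem 5 = (fun _ => 0) ∧ Filled (s'.mem 4) r b n (prefixSum b n + 1))
    ?_ ?_ b.length ?_) ?_) ?_
  · rintro n s' ⟨hn, h', -⟩
    simp only [Expr.Fits, Expr.eval, h'.reg4, and_true]; omega
  · rintro n s' ⟨hn, h', h5, hF⟩
    refine (run_rowProgram hr hb hW h' (by omega) h5 hF).imp ?_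
    rintro s'' ⟨g1, g2, g3⟩
    exact ⟨by omega, g1, g2, g3⟩
  · exact ⟨le_rfl, h, h5, hF⟩
  · rintro s' ⟨-, h'⟩
    exact h'
  · exact Nat.mul_le_mul (by omega) (by simp only [Expr.cost]; omega)

end Table

/-! ### Construction of the tree -/

theorem starts_concat (c : ℕ) (l : List ℕ) (a : ℕ) :
    starts c (l ++ [a]) = starts c l ++ [c + l.sum] := by
  induction l generalizing c with
  | nil => simp [starts]
  | cons x l ih => simp [starts, ih, add_assoc]

/-- Places the next weight at an end and marks the first number of its block. -/
def placeStep : Program :=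
  .seq (.assign 8 (.read 3 (.reg 4))) <|
  .seq
    (.ifLt leftExpr rightExpr
      (.store 5 (.sub (.reg 0) (.add (.sub (.reg 5) (.reg 6)) (.reg 8))) (.lit 1))
      (.seq (.store 5 (.add (.reg 6) (.lit 2)) (.lit 1))
        (.assign 6 (.add (.reg 6) (.reg 8))))) <|
  .seq (.assign 5 (.add (.reg 5) (.reg 8))) <|
  .assign 4 (.add (.reg 4) (.lit 1))

/-- Marks the first numbers of the blocks of the best arrangement. -/
def placeProgram : Program :=
  .seq (.assign 6 (.lit 0)) (.whileLt (.reg 4) (.reg 1) placeStep)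

/-- Outputs the edge between the vertex in register `2` and its parent. -/
def edgeStep : Program :=
  .seq (.ifLt (.lit 0) (.read 5 (.reg 2)) (.assign 3 (.sub (.reg 2) (.lit 1))) .skip) <|
  .seq (.store 1 (.sub (.reg 2) (.lit 1)) (.reg 2)) <|
  .seq (.store 2 (.sub (.reg 2) (.lit 1)) (.reg 3)) <|
  .assign 2 (.add (.reg 2) (.lit 1))

/-- Outputs the edges between all vertices and their parents. -/
def edgeProgram : Program :=
  .seq (.assign 2 (.lit 1)) <|
  .seq (.assign 3 (.lit 0)) <|
  .whileLt (.reg 2) (.reg 0) edgeStep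

/-- The algorithm. -/
def treeProgram : Program :=
  .seq sortProgram (.seq tableProgram (.seq placeProgram edgeProgram))

/-- The invariant of the placing phase. -/
structure PlaceInv (r : ℕ) (b : List ℕ) (t L : ℕ) (s : State) : Prop where
  row : RowInv r b t s
  reg6 : s.reg 6 = L
  le : L ≤ prefixSum b t
  filled : Filled (s.mem 4) r b 0 (prefixSum b 0 + 1)
  mark_le : ∀ v, s.mem 5 v ≤ 1
  mark : ∀ v, v ∈ starts 2 (bestArrangement 0 0 b) ↔
    0 < s.mem 5 v ∨ v ∈ starts (2 + L) (bestArrangement L (prefixSum b t - L) (b.drop t))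

section Placing

variable {W r t L : ℕ} {b : List ℕ} {s : State}

theorem update_one_le {f : ℕ → ℕ} (hf : ∀ v, f v ≤ 1) (i v : ℕ) : Function.update f i 1 v ≤ 1 := by
  rw [Function.update_apply]
  split_ifs
  · exact le_rfl
  · exact hf v

theorem update_one_pos_iff {f : ℕ → ℕ} {i v : ℕ} :
    0 < Function.update f i 1 v ↔ 0 < f v ∨ v = i := by
  rw [Function.update_apply]
  split_ifs with h <;> simp [h]

theorem Filled.tail {V : ℕ → ℕ} (h : Filled V r b 0 (prefixSum b 0 + 1)) (t : ℕ) :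
    Filled V r b t 0 := by
  intro t' L' h1 h2 h3
  refine h t' L' h1 h2 ?_
  rcases Nat.eq_zero_or_pos t' with h4 | h4
  · subst h4; exact Or.inr ⟨rfl, by omega⟩
  · exact Or.inl h4

/-- Choices are not stored; the comparison of the table phase is repeated and agrees with the test
in `bestArrangement`, ties included. The starts still missing are those of the best arrangement of
the remaining weights, shifted to begin at `2 + L`. -/
theorem run_placeStep (hr : b.sum + 2 = r) (hb : b.length ≤ r) (hW : 8 * r ^ 3 ≤ W)
    (ht : t < b.length) (h : PlaceInv r b t L s) :
    Run W placeStep s 80 fun s' => ∃ L', PlaceInv r b (t + 1) L' s' := by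
  obtain ⟨w1, w2, w3, w4⟩ := word_bounds (by omega) hW
  have hsum := prefixSum_add b (t + 1)
  have hs := prefixSum_succ ht
  have hbt : s.mem 3 t = b[t] := h.row.mem3 t ht
  have hL := h.le
  have hmark := h.mark
  rw [List.drop_eq_getElem_cons ht, bestArrangement] at hmark
  have hperm : ∀ R, (bestArrangement L R (b.drop (t + 1))).sum = (b.drop (t + 1)).sum := fun R =>
    (bestArrangement_perm _ _ _).sum_eq
  refine Run.mono (Run.assign_seq ?_ <| Run.seq (T₁ := 64) (T₂ := 8) (Q' := fun s' =>
    RowInv r b t s' ∧ s'.reg 8 = b[t] ∧ Filled (s'.mem 4) r b 0 (prefixSum b 0 + 1) ∧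
      (∀ v, s'.mem 5 v ≤ 1) ∧ ∃ L', s'.reg 6 = L' ∧ L' ≤ prefixSum b (t + 1) ∧
        ∀ v, v ∈ starts 2 (bestArrangement 0 0 b) ↔ 0 < s'.mem 5 v ∨ v ∈ starts (2 + L')
          (bestArrangement L' (prefixSum b (t + 1) - L') (b.drop (t + 1)))) ?_ ?_) ?_
  · simp only [Expr.Fits, Expr.eval, h.row.reg4, hbt]; omega
  · set s₁ := s.setReg 8 ((Expr.read 3 (.reg 4)).eval s) with hs₁
    have hrow : RowInv r b t s₁ := h.row.setReg (Or.inr rfl)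
    have h6 : s₁.reg 6 = L := by simp [hs₁, State.reg_setReg, h.reg6]
    have h8 : s₁.reg 8 = b[t] := by
      simp [hs₁, State.reg_setReg, Expr.eval, h.row.reg4, hbt]
    have hmem : s₁.mem = s.mem := rfl
    have hF : Filled (s₁.mem 4) r b t 0 := h.filled.tail t
    obtain ⟨hlf, hle⟩ := leftExpr_spec hr hb hW hrow ht h6 hL h8 hF
    obtain ⟨hrf, hre⟩ := rightExpr_spec hr hb hW hrow ht h6 hL hF
    rw [← hle, ← hre] at hmark
    clear_value s₁
    refine Run.mono (Run.ifLt (T := 16) hlf hrf ?_ ?_) (by simp [Expr.cost, leftExpr, rightExpr])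
    · intro hlt
      rw [if_pos hlt] at hmark
      -- Blocks fill the numbers 2 to `r - 1`. A block placed on the right ends where the right part
      -- begins, so its start can be measured from `r`.
      have hidx : r - (prefixSum b t - L + b[t]) = 2 + L + (b.drop (t + 1)).sum := by omega
      refine Run.mono (Run.store ?_ ?_ ⟨?_, ?_, ?_, ?_, L, ?_, by omega, ?_⟩) (by simp [Expr.cost])
      · simp only [Expr.Fits, Expr.eval, hrow.reg0, hrow.reg5, h6, h8]; omega
      · simp only [Expr.Fits]; omega
      · constructor <;> simp [State.reg_setMem, State.mem_setMem, hrow.reg0, hrow.reg1, hrow.reg4,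
          hrow.reg5, hrow.reg7, hrow.mem3]
      · simp [State.reg_setMem, h8]
      · simpa [State.mem_setMem, hmem] using h.filled
      · simpa [State.mem_setMem, hmem, Expr.eval] using update_one_le h.mark_le _
      · simp [State.reg_setMem, h6]
      · intro v
        rw [hmark, starts_concat, hperm, List.mem_append, List.mem_singleton, ← hidx,
          show prefixSum b (t + 1) - L = prefixSum b t - L + b[t] by omega]
        simp only [State.mem_setMem, if_true, Expr.eval, hrow.reg0, hrow.reg5, h6, h8, hmem,
          update_one_pos_iff]
        tauto
    · intro hlt
      rw [if_neg hlt] at hmark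
      refine Run.mono (Run.store_seq ?_ ?_ (Run.assign ?_
        ⟨?_, ?_, ?_, ?_, L + b[t], ?_, by omega, ?_⟩)) (by simp [Expr.cost])
      · simp only [Expr.Fits, Expr.eval, h6]; omega
      · simp only [Expr.Fits]; omega
      · simp only [Expr.Fits, Expr.eval, State.reg_setMem, h6, h8]; omega
      · refine RowInv.setReg ?_ (Or.inl rfl)
        constructor <;> simp [State.reg_setMem, State.mem_setMem, hrow.reg0, hrow.reg1, hrow.reg4,
          hrow.reg5, hrow.reg7, hrow.mem3]
      · simp [State.reg_setReg, State.reg_setMem, h8]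
      · simpa [State.mem_setReg, State.mem_setMem, hmem] using h.filled
      · simpa [State.mem_setReg, State.mem_setMem, hmem, Expr.eval] using
          update_one_le h.mark_le _
      · simp [State.reg_setReg, State.reg_setMem, Expr.eval, h6, h8]
      · intro v
        rw [hmark, starts, List.mem_cons, add_assoc 2 L,
          show prefixSum b (t + 1) - (L + b[t]) = prefixSum b t - L by omega]
        simp only [State.mem_setReg, State.mem_setMem, if_true, Expr.eval, h6, hmem,
          update_one_pos_iff, add_comm 2 L]
        tauto
  · rintro s' ⟨hrow, h8, hF, hm1, L', h6, hL', hm⟩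
    refine Run.mono (Run.assign_seq ?_ (Run.assign ?_ ⟨L', ?_, ?_, hL', ?_, ?_, ?_⟩))
      (by simp [Expr.cost])
    · simp only [Expr.Fits, Expr.eval, hrow.reg5, h8]; omega
    · simp only [Expr.Fits, Expr.eval, State.reg_setReg, hrow.reg4]; simp; omega
    · have hmem := hrow.mem3
      constructor <;> simp [State.reg_setReg, State.mem_setReg, Expr.eval, hrow.reg0, hrow.reg1,
        hrow.reg4, hrow.reg5, hrow.reg7, h8, hs, hmem]
    · simp [State.reg_setReg, h6]
    · exact hF
    · exact hm1
    · exact hm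
  · simp [Expr.cost]

theorem run_placeProgram (hr : b.sum + 2 = r) (hb : b.length ≤ r) (hW : 8 * r ^ 3 ≤ W)
    (h : RowInv r b 0 s) (hm5 : s.mem 5 = fun _ => 0)
    (hF : Filled (s.mem 4) r b 0 (prefixSum b 0 + 1)) :
    Run W placeProgram s ((r + 1) * 83 + 2) fun s' => s'.reg 0 = r ∧ (∀ v, s'.mem 5 v ≤ 1) ∧
      ∀ v, 0 < s'.mem 5 v ↔ v ∈ starts 2 (bestArrangement 0 0 b) := by
  obtain ⟨w1, w2, w3, w4⟩ := word_bounds (by omega) hW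
  refine Run.mono (Run.assign_seq (by simp [Expr.Fits]) (Run.imp (Run.whileLt (T := 80)
    (I := fun n s' => n ≤ b.length ∧ ∃ L, PlaceInv r b (b.length - n) L s') ?_ ?_ b.length ?_)
    ?_)) (T := 2 + (b.length + 1) * 83) ?_
  · rintro n s' ⟨hn, L, h'⟩
    simp only [Expr.Fits, Expr.eval, h'.row.reg4, h'.row.reg1]; omega
  · rintro n s' ⟨hn, L, h'⟩
    refine (run_placeStep hr hb hW (by omega) h').imp ?_
    rintro s'' ⟨L', h''⟩
    rw [show b.length - (n + 1) + 1 = b.length - n by omega] at h''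
    exact ⟨by omega, L', h''⟩
  · refine ⟨le_rfl, 0, ?_⟩
    rw [Nat.sub_self]
    refine ⟨h.setReg (Or.inl rfl), ?_, Nat.zero_le _, hF, ?_, ?_⟩
    · simp [State.reg_setReg, Expr.eval]
    · simp [State.mem_setReg, hm5]
    · simp [State.mem_setReg, hm5, prefixSum]
  · rintro s' ⟨-, L, h'⟩
    refine ⟨h'.row.reg0, h'.mark_le, fun v => ?_⟩
    rw [h'.mark, Nat.sub_zero, List.drop_length, bestArrangement, starts]
    simp
  · have := Nat.mul_le_mul_right 83 (Nat.succ_le_succ hb)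
    simp only [Nat.succ_eq_add_one] at this
    omega

end Placing

/-- The invariant of the output phase. -/
structure EdgeInv (r : ℕ) (mark : ℕ → ℕ) (v : ℕ) (s : State) : Prop where
  reg0 : s.reg 0 = r
  reg2 : s.reg 2 = v
  reg3 : s.reg 3 = parent mark (v - 1)
  pos : 0 < v
  mem5 : s.mem 5 = mark
  edges : ∀ j, j + 1 < v → s.mem 1 j = j + 1 ∧ s.mem 2 j = parent mark (j + 1)

section Edges

variable {W r v : ℕ} {mark : ℕ → ℕ} {s : State}

theorem parent_le (mark : ℕ → ℕ) (v : ℕ) : parent mark v ≤ v := by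
  rcases Nat.eq_zero_or_pos v with h | h
  · subst h; simp [parent]
  · exact (parent_lt mark v h.ne').le

/-- Register 3 carries the parent of the previous vertex; it changes only at a mark, where a new
block begins below the preceding number. -/
theorem run_edgeStep (hW : r + 1 ≤ W) (hmark : ∀ v, mark v ≤ 1) (hv : v < r)
    (h : EdgeInv r mark v s) : Run W edgeStep s 30 (EdgeInv r mark (v + 1)) := by
  have hpos := h.pos
  obtain ⟨w, rfl⟩ : ∃ w, v = w + 1 := ⟨v - 1, by omega⟩
  have hp := parent_le mark (w + 1)
  have hm := hmark (w + 1)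
  refine Run.mono (Run.seq (T₁ := 10) (T₂ := 20) (Q' := fun s' => s'.reg 0 = r ∧
    s'.reg 2 = w + 1 ∧ s'.reg 3 = parent mark (w + 1) ∧ s'.mem = s.mem) ?_ ?_) (by norm_num)
  · refine Run.mono (Run.ifLt (T := 4) ?_ ?_ ?_ ?_) (by simp [Expr.cost])
    · simp only [Expr.Fits]; omega
    · simp only [Expr.Fits, Expr.eval, h.reg2, h.mem5]; omega
    · intro hlt
      simp only [Expr.eval, h.reg2, h.mem5] at hlt
      refine Run.mono (Run.assign ?_ ⟨?_, ?_, ?_, rfl⟩) (by simp [Expr.cost])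
      · simp only [Expr.Fits, h.reg2]; omega
      · simp [State.reg_setReg, h.reg0]
      · simp [State.reg_setReg, h.reg2]
      · simp [State.reg_setReg, Expr.eval, h.reg2, parent, hlt]
    · intro hlt
      simp only [Expr.eval, h.reg2, h.mem5] at hlt
      refine Run.mono (Run.skip ⟨h.reg0, h.reg2, ?_, rfl⟩) (by norm_num)
      rw [h.reg3, parent, if_neg hlt, Nat.add_sub_cancel]
  · rintro s' ⟨h0, h2, h3, hmem⟩
    refine Run.mono (Run.store_seq ?_ ?_ <| Run.store_seq ?_ ?_ <| Run.assign ?_ ?_)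
      (by simp [Expr.cost])
    · simp only [Expr.Fits, h2]; omega
    · simp only [Expr.Fits, h2]; omega
    · simp only [Expr.Fits, State.reg_setMem, h2]; omega
    · simp only [Expr.Fits, State.reg_setMem, h3]; omega
    · simp only [Expr.Fits, Expr.eval, State.reg_setMem, h2]; omega
    · constructor
      · simp [State.reg_setReg, State.reg_setMem, h0]
      · simp [State.reg_setReg, State.reg_setMem, Expr.eval, h2]
      · simp [State.reg_setReg, State.reg_setMem, h3]
      · omega
      · simp [State.mem_setReg, State.mem_setMem, hmem, h.mem5]
      · intro j hj
        simp only [State.mem_setReg, State.mem_setMem, State.reg_setMem, Expr.eval, h2, h3, hmem]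
        by_cases hjw : j = w
        · subst hjw; simp
        · have := h.edges j (by omega)
          simpa [hjw] using this

theorem run_edgeProgram (hr : 0 < r) (hW : r + 1 ≤ W) (h0 : s.reg 0 = r)
    (hmark : ∀ v, s.mem 5 v ≤ 1) :
    Run W edgeProgram s (r * 33 + 4) (EdgeInv r (s.mem 5) r) := by
  refine Run.mono (Run.assign_seq ?_ <| Run.assign_seq ?_ <| Run.imp (Run.whileLt (T := 30)
    (I := fun n s' => n < r ∧ EdgeInv r (s.mem 5) (r - n) s') ?_ ?_ (r - 1) ?_) ?_) ?_
  · simp only [Expr.Fits]; omega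
  · simp [Expr.Fits]
  · rintro n s' ⟨hn, h⟩
    simp only [Expr.Fits, Expr.eval, h.reg0, h.reg2]; omega
  · rintro n s' ⟨hn, h⟩
    refine (run_edgeStep hW hmark (by omega) h).imp fun s'' h' => ?_
    rw [show r - (n + 1) + 1 = r - n by omega] at h'
    exact ⟨by omega, h'⟩
  · refine ⟨by omega, ?_⟩
    rw [show r - (r - 1) = 1 by omega]
    constructor <;> simp [State.reg_setReg, State.mem_setReg, Expr.eval, h0, parent]
  · rintro s' ⟨-, h⟩
    exact h
  · simp only [Expr.cost]
    rw [Nat.sub_add_cancel hr]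
    omega

theorem EdgeInv.holdsGraph (h : EdgeInv r mark r s) :
    s.HoldsGraph (parentGraph r (parent mark)) := by
  refine ⟨fun j hj => ?_, fun u v => ?_⟩
  · have := h.edges j hj
    have := parent_lt mark (j + 1) (Nat.succ_ne_zero j)
    omega
  · rw [parentGraph_adj (parent_lt mark)]
    constructor
    · rintro (⟨h0, hp⟩ | ⟨h0, hp⟩)
      · have hu := h.edges (u - 1) (by omega)
        rw [Nat.sub_add_cancel (Nat.pos_of_ne_zero h0)] at hu
        exact ⟨u - 1, by omega, Or.inl ⟨hu.1, hu.2.trans hp⟩⟩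
      · have hv := h.edges (v - 1) (by omega)
        rw [Nat.sub_add_cancel (Nat.pos_of_ne_zero h0)] at hv
        exact ⟨v - 1, by omega, Or.inr ⟨hv.1, hv.2.trans hp⟩⟩
    · rintro ⟨j, hj, hjj⟩
      obtain ⟨e1, e2⟩ := h.edges j hj
      rw [e1, e2] at hjj
      rcases hjj with ⟨g1, g2⟩ | ⟨g1, g2⟩
      · exact Or.inl ⟨by omega, by rw [← g1, g2]⟩
      · exact Or.inr ⟨by omega, by rw [← g1, g2]⟩

end Edges

/-! ### Assembly of the phases -/

/-- The algorithm is correct, takes quadratic time and uses words of logarithmic length. -/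
theorem run_treeProgram {r : ℕ} {d : Fin r → ℕ} (hd : ∀ i, 0 < d i)
    (hsum : (∑ i, d i) + 2 = 2 * r) :
    Run (r ^ 6) treeProgram (State.input d) (1000 * r ^ 2) fun s => ∃ T : SimpleGraph (Fin r),
      s.HoldsGraph T ∧ T.IsTree ∧ HasDegreeSequence T d ∧
        ∀ T' : SimpleGraph (Fin r), T'.IsTree → HasDegreeSequence T' d →
          wienerIndex T' ≤ wienerIndex T := by
  have hge : r ≤ ∑ i, d i := by
    have := Finset.sum_le_sum (s := Finset.univ) fun i _ => Nat.succ_le_of_lt (hd i)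
    simpa using this
  have hr : 2 ≤ r := by omega
  -- The exponent 6 comes from here: `8 ≤ r ^ 3` because `r ≥ 2`, so `r ^ 6` absorbs the factor in
  -- the cubic word bound.
  have hW : 8 * r ^ 3 ≤ r ^ 6 := by
    rw [show 6 = 3 + 3 from rfl, pow_add]
    exact Nat.mul_le_mul_right _ (Nat.pow_le_pow_left hr 3)
  obtain ⟨w1, w2, w3, w4⟩ := word_bounds hr hW
  have hsub : ∑ i, (d i - 1) + 2 = r := by
    have : ∑ i, (d i - 1) + ∑ i : Fin r, 1 = ∑ i, d i := by
      rw [← Finset.sum_add_distrib]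
      exact Finset.sum_congr rfl fun i _ => Nat.sub_add_cancel (hd i)
    rw [Finset.sum_const, Finset.card_univ, Fintype.card_fin, smul_eq_mul, mul_one] at this
    omega
  have hD : ∀ i : Fin r, (State.input d).mem 0 i = d i := fun i => by simp [State.input]
  -- One reduced degree is at most their sum `r - 2`, so each degree is below `r`; the sorting phase
  -- starts from the value `r`.
  have hlt : ∀ j < r, (State.input d).mem 0 j < r := by
    intro j hj
    rw [hD ⟨j, hj⟩]
    have := Finset.single_le_sum (f := fun i => d i - 1) (fun i _ => Nat.zero_le _)
      (Finset.mem_univ (⟨j, hj⟩ : Fin r))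
    omega
  refine Run.mono (Run.seq (run_sortProgram (by omega) (by omega) hlt (by simp [State.input])
    (by simp [State.input]) rfl (by funext i; simp [State.input]))
    (T₂ := 20 * r + 20 + (r + 1) * (90 * r + 23) + ((r + 1) * 83 + 2 + (r * 33 + 4))) ?_) ?_
  · rintro s ⟨b, h⟩
    have hlist := h.collects.listsNonzero hd hD
    have hb := h.collects.length_le
    have hbs : b.sum + 2 = r := by
      have := hlist.2 id rfl
      simp only [List.map_id, id] at this
      omega
    refine Run.seq (run_tableProgram hbs hb hW h.reg0 h.reg1 h.mem3 h.mem5) ?_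
    rintro s₁ ⟨hrow, h5, hF⟩
    refine Run.seq (run_placeProgram hbs hb hW hrow h5 hF) ?_
    rintro s₂ ⟨h0, hle, hmark⟩
    refine (run_edgeProgram (by omega) (by omega) h0 hle).imp fun s₃ h₃ => ?_
    exact ⟨_, h₃.holdsGraph, caterpillar_optimal hd hbs.symm h.collects.sorted hlist hmark⟩
  -- The phases add up to 123 r² plus lower order terms, which `r ≥ 2` absorbs into the generous
  -- constant 1000.
  · nlinarith

end WienerTree

/-- One fixed program with two constants `C` and `k` that depend on nothing: for every sequence of
`r` positive integers with sum `2 * r - 2`, it halts within `C * r ^ 2` steps on a machine with words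
of `k * log r` bits and outputs a tree that has this degree sequence and whose Wiener index is
largest among all trees with this degree sequence. -/
theorem theorem5p2 :
    ∃ (P : WienerTree.Program) (C k : ℕ), ∀ (r : ℕ) (d : Fin r → ℕ),
      (∀ i, 0 < d i) → (∑ i, d i) + 2 = 2 * r →
        ∃ (t : ℕ) (s : WienerTree.State) (T : SimpleGraph (Fin r)),
          WienerTree.Exec (r ^ k) P (WienerTree.State.input d) t s ∧ t ≤ C * r ^ 2 ∧
          s.HoldsGraph T ∧ T.IsTree ∧ WienerTree.HasDegreeSequence T d ∧
          ∀ T' : SimpleGraph (Fin r), T'.IsTree → WienerTree.HasDegreeSequence T' d →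
            WienerTree.wienerIndex T' ≤ WienerTree.wienerIndex T := by
  refine ⟨WienerTree.treeProgram, 1000, 6, fun r d hd hsum => ?_⟩
  obtain ⟨t, s, hexec, ht, T, h⟩ := WienerTree.run_treeProgram hd hsum
  exact ⟨t, s, T, hexec, ht, h⟩
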